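/- Let $\kappa$ be an algebraically closed field with $\operatorname{char}\kappa\neq 2$, let $G=\mathrm{Sp}_{2n}(\kappa)$ be the symplectic group acting by conjugation on its Lie algebra $\mathfrak{sp}_{2n}(\kappa)$, and write $\mathcal{O}(x)=G\cdot x$. For $x,y\in\mathfrak{sp}_{2n}(\kappa)$, the orbit $\mathcal{O}(y)$ is called 1-accessible from $\mathcal{O}(x)$ if there is a cocharacter $\lambda:\mathbb{G}_m\to G$ (a homomorphism of algebraic groups) such that $t\mapsto \lambda(t)\,x\,\lambda(t)^{-1}$ extends to a morphism on $\mathbb{A}^1$ whose value at $0$ lies in $\mathcal{O}(y)$; it is called accessible from $\mathcal{O}(x)$ if there is a finite chain $x=x_0,x_1,\dots,x_k=y$ in $\mathfrak{sp}_{2n}(\kappa)$ with $\mathcal{O}(x_i)$ 1-accessible from $\mathcal{O}(x_{i-1})$ for $1\le i\le k$. Call a partition of $2n$ symplectic if each of its odd parts has even multiplicity; the nilpotent $G$-orbits are labelled by the symplectic partitions of $2n$ via the sizes of the Jordan blocks. Let $r,s\ge 0$ be integers with $2r\ge 2s+6$, and let $\pi_1=[\ldots,2r,2s,\ldots]$ and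 $\pi_2=[\ldots,2r-2,2s+2,\ldots]$ be symplectic partitions of $2n$ that differ only in the displayed parts (a part $2s=0$ is omitted from $\pi_1$). Suppose that $\pi_1$ and $\pi_2$ are adjacent in the dominance order on symplectic partitions of $2n$, that is, no symplectic partition of $2n$ lies strictly between $\pi_2$ and $\pi_1$. If $x,y\in\mathfrak{sp}_{2n}(\kappa)$ are nilpotent with Jordan block sizes given by $\pi_1$ and $\pi_2$ respectively, then $\mathcal{O}(y)$ is not accessible from $\mathcal{O}(x)$. -/

import Mathlib

open scoped Matrix

namespace SpAccess

/-! ### Partitions -/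

/-- The sum of the `k` largest parts of a partition. -/
def partialSum {N : ℕ} (p : Nat.Partition N) (k : ℕ) : ℕ :=
  ((p.parts.sort (fun a b => b ≤ a)).take k).sum

/-- `Dominates p q`: `q ≤ p` in the dominance order on partitions. -/
def Dominates {N : ℕ} (p q : Nat.Partition N) : Prop :=
  ∀ k : ℕ, partialSum q k ≤ partialSum p k

/-- The partitions labelling the nilpotent orbits of the symplectic group:
every odd part occurs with even multiplicity. -/
def IsSymplecticPartition {N : ℕ} (p : Nat.Partition N) : Prop :=
  ∀ a ∈ p.parts, Odd a → Even (p.parts.count a)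

/-- `p` and `q` are adjacent in the dominance order on symplectic partitions, with `p` the larger
one: `q < p`, and no symplectic partition lies strictly between them. -/
def AdjacentBelow {N : ℕ} (q p : Nat.Partition N) : Prop :=
  Dominates p q ∧ p ≠ q ∧
    ∀ m : Nat.Partition N, IsSymplecticPartition m → Dominates p m → Dominates m q →
      m = p ∨ m = q

/-! ### Jordan type -/

/-- `x` is nilpotent and its Jordan blocks have the sizes listed in the multiset `π`: there is a
basis consisting of chains `b ⟨i, d i - 1⟩ ↦ ⋯ ↦ b ⟨i, 1⟩ ↦ b ⟨i, 0⟩ ↦ 0` whose lengths `d i`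
are the members of `π`. -/
def HasJordanType {κ m : Type*} [Field κ] [Fintype m] (x : Matrix m m κ) (π : Multiset ℕ) :
    Prop :=
  ∃ (k : ℕ) (d : Fin k → ℕ) (b : Module.Basis (Σ i : Fin k, Fin (d i)) κ (m → κ)),
    Finset.univ.val.map d = π ∧
    (∀ (i : Fin k) (h : 0 < d i), x *ᵥ b ⟨i, ⟨0, h⟩⟩ = 0) ∧
    (∀ (i : Fin k) (j : ℕ) (h : j + 1 < d i),
      x *ᵥ b ⟨i, ⟨j + 1, h⟩⟩ = b ⟨i, ⟨j, Nat.lt_of_succ_lt h⟩⟩)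

/-! ### The symplectic group, its adjoint action, cocharacters and limits -/

/-- The symplectic group `Sp_{2n}(κ)`. -/
abbrev Sp (n : ℕ) (κ : Type*) [Field κ] := Matrix.symplecticGroup (Fin n) κ

/-- The symplectic Lie algebra `sp_{2n}(κ)`. -/
abbrev sp (n : ℕ) (κ : Type*) [Field κ] := LieAlgebra.Symplectic.sp (Fin n) κ

/-- The orbit of `y` under the adjoint action (conjugation) of `Sp_{2n}(κ)`. -/
def orbit {n : ℕ} {κ : Type*} [Field κ] (y : sp n κ) : Set (sp n κ) :=
  {z | ∃ g : Sp n κ, z.1 = g.1 * y.1 * (g⁻¹).1}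

/-- A cocharacter of `Sp_{2n}` over an (algebraically closed) field `κ`: a homomorphism from
`κˣ` to `Sp_{2n}(κ)` that is a morphism of varieties, i.e. whose matrix entries are
Laurent polynomial functions. -/
structure Cocharacter (n : ℕ) (κ : Type*) [Field κ] where
  toHom : κˣ →* Sp n κ
  regular : ∀ i j : Fin n ⊕ Fin n, ∃ p : LaurentPolynomial κ,
    ∀ t : κˣ, (toHom t).1 i j = LaurentPolynomial.eval₂ (RingHom.id κ) t p

/-- `z = lim_c x`: the morphism `t ↦ c(t) x c(t)⁻¹` on `κˣ` extends to a morphism on the affine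
line (matrix entries given by polynomials) whose value at `0` is `z`. -/
def HasLimit {n : ℕ} {κ : Type*} [Field κ] (c : Cocharacter n κ) (x z : sp n κ) : Prop :=
  ∃ P : Matrix (Fin n ⊕ Fin n) (Fin n ⊕ Fin n) (Polynomial κ),
    (∀ t : κˣ, P.map (Polynomial.eval (t : κ)) =
      (c.toHom t).1 * x.1 * ((c.toHom t)⁻¹).1) ∧
    P.map (Polynomial.eval 0) = z.1

/-- The orbit of `y` is 1-accessible from the orbit of `x`. -/
def OneAccessible {n : ℕ} {κ : Type*} [Field κ] (x y : sp n κ) : Prop :=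
  ∃ (c : Cocharacter n κ) (z : sp n κ), HasLimit c x z ∧ z ∈ orbit y

/-- The orbit of `y` is accessible from the orbit of `x`: there is a finite chain of
1-accessible orbits leading from `x` to `y`. -/
def Accessible {n : ℕ} {κ : Type*} [Field κ] (x y : sp n κ) : Prop :=
  Relation.ReflTransGen OneAccessible x y

end SpAccess

namespace SpAccess

open Module

/-! ### Ranks of powers, gaps in Jordan block sizes, and extensions of endomorphisms. -/

section LinearAlgebra

variable {K : Type*} [Field K] {W V Q : Type*} [AddCommGroup W] [Module K W]
  [AddCommGroup V] [Module K V] [AddCommGroup Q] [Module K Q]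

/-! A nilpotent Jordan type is read off from the ranks of powers: the rank of `x ^ j` is `excess π
j`, a convex function of `j` whose second differences are the multiplicities of the parts. Larger
excess functions mean larger partitions in dominance order. Ranks of powers cannot grow in a limit,
and for elements of the Lie algebra even powers have even rank, so every member of a chain from `x`
to `y` has a symplectic type squeezed between `q` and `p`. Adjacency leaves only these two types, so
some single step goes from type `p` to type `q`; such a step is ruled out in
`not_hasLimit_of_adjacentBelow`.

Let `z` be a limit of `x` along a cocharacter, and split the space into its negative, zero and
positive weight parts. Then `x` is block triangular and `z` is its block diagonal part with respect
to single weights; the zero blocks coincide, and the outer blocks of `z` are dual under the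
symplectic form, so `rank (z ^ j) = 2 σ j + τ j` with `σ` an outer and `τ` the zero contribution.
Adjacency forbids further parts strictly between `2s` and `2r` (`not_mem_of_adjacentBelow`), so in
that range `q` has only the distinct parts `2r - 2` and `2s + 2`, each once. An outer block of `z`
would contribute its sizes twice, hence contributes none there, and `σ` is affine on `[2s, 2r]`.

The ranks of the powers of `x` and `z` agree in degrees `2s` and `2r`. This forces the outer blocks
of `x` to have the same ranks as those of `z` there, hence no block sizes strictly between either,
and forces ranks to be additive along the weight filtration in these two degrees. The lemmas
`strict_of_noMiddleBlocks_left` and `strict_of_noMiddleBlocks_right` propagate additivity to all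
degrees between (`IsBlockDiagonalPart.finrank_range_eq`). So the ranks would agree in degree `2r -
1`, where the excesses of `p` and `q` differ by one. -/

theorem finrank_map_add_finrank_ker_inf [FiniteDimensional K V] (f : V →ₗ[K] Q)
    (R : Submodule K V) :
    finrank K (R.map f) + finrank K (LinearMap.ker f ⊓ R : Submodule K V) = finrank K R := by
  have h := LinearMap.finrank_range_add_finrank_ker (f.domRestrict R)
  rw [LinearMap.range_domRestrict, LinearMap.ker_domRestrict] at h
  rw [← h, inf_comm, ← Submodule.map_comap_subtype,
    (Submodule.equivMapOfInjective R.subtype (Submodule.subtype_injective R) _).finrank_eq]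

theorem range_pow_succ (b : End K V) (j : ℕ) :
    (LinearMap.range (b ^ j)).map b = LinearMap.range (b ^ (j + 1)) := by
  rw [pow_succ', Module.End.mul_eq_comp, LinearMap.range_comp]

theorem range_pow_antitone (b : End K V) {i j : ℕ} (h : i ≤ j) :
    LinearMap.range (b ^ j) ≤ LinearMap.range (b ^ i) := by
  obtain ⟨k, rfl⟩ := Nat.exists_eq_add_of_le h
  rintro _ ⟨v, rfl⟩
  exact ⟨(b ^ k) v, by rw [pow_add, Module.End.mul_apply]⟩

theorem finrank_range_pow_succ_add [FiniteDimensional K V] (b : End K V) (j : ℕ) :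
    finrank K (LinearMap.range (b ^ (j + 1))) +
      finrank K (LinearMap.ker b ⊓ LinearMap.range (b ^ j) : Submodule K V) =
      finrank K (LinearMap.range (b ^ j)) := by
  rw [← range_pow_succ, finrank_map_add_finrank_ker_inf]

theorem finrank_range_pow_convex [FiniteDimensional K V] (b : End K V) (j : ℕ) :
    2 * finrank K (LinearMap.range (b ^ (j + 1))) ≤
      finrank K (LinearMap.range (b ^ j)) + finrank K (LinearMap.range (b ^ (j + 2))) := by
  have h1 := finrank_range_pow_succ_add b j
  have h2 := finrank_range_pow_succ_add b (j + 1)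
  have h3 : finrank K (LinearMap.ker b ⊓ LinearMap.range (b ^ (j + 1)) : Submodule K V) ≤
      finrank K (LinearMap.ker b ⊓ LinearMap.range (b ^ j) : Submodule K V) :=
    Submodule.finrank_mono (inf_le_inf le_rfl (range_pow_antitone b (Nat.le_succ j)))
  rw [show j + 2 = j + 1 + 1 from rfl]
  omega

/-- `b` has no Jordan blocks for the eigenvalue `0` whose size lies strictly between
`m` and `M`. -/
def NoMiddleBlocks (b : End K V) (m M : ℕ) : Prop :=
  LinearMap.ker b ⊓ LinearMap.range (b ^ m) ≤ LinearMap.range (b ^ (M - 1))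

/-- Induction on `i`: apply the hypothesis to `b ^ i v`, then correct `v` by an element of the range
of `b ^ (M - (i + 1))` with the same image under `b ^ i`. -/
theorem NoMiddleBlocks.ker_pow_inf_range_le {b : End K V} {m M : ℕ} (h : NoMiddleBlocks b m M)
    {i : ℕ} (hi : m + i ≤ M) :
    LinearMap.ker (b ^ i) ⊓ LinearMap.range (b ^ m) ≤ LinearMap.range (b ^ (M - i)) := by
  induction i with
  | zero =>
    rintro v ⟨hv, -⟩
    have : v = 0 := by simpa using hv
    rw [this]; exact Submodule.zero_mem _
  | succ i ih =>
    rintro v ⟨hv, hv'⟩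
    have hbv : (b ^ i) v ∈ LinearMap.ker b ⊓ LinearMap.range (b ^ m) := by
      refine ⟨?_, ?_⟩
      · have : (b ^ (i + 1)) v = 0 := hv
        rw [pow_succ'] at this
        exact this
      · obtain ⟨u, rfl⟩ := hv'
        exact ⟨(b ^ i) u, by rw [← Module.End.mul_apply, ← Module.End.mul_apply, ← pow_add,
          ← pow_add, add_comm]⟩
    obtain ⟨u, hu⟩ := h hbv
    have hsplit : (b ^ (M - 1)) u = (b ^ i) ((b ^ (M - (i + 1))) u) := by
      rw [← Module.End.mul_apply, ← pow_add]; congr 3; omega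
    have h1 : v - (b ^ (M - (i + 1))) u ∈ LinearMap.range (b ^ (M - i)) := by
      apply ih (by omega)
      refine ⟨?_, Submodule.sub_mem _ hv' (range_pow_antitone b (by omega) ⟨u, rfl⟩)⟩
      change (b ^ i) _ = 0
      rw [map_sub, ← hsplit, hu, sub_self]
    have h2 := Submodule.add_mem _ (range_pow_antitone b (i := M - (i + 1)) (by omega) h1) ⟨u, rfl⟩
    simpa using h2

theorem NoMiddleBlocks.exists_decomposition {b : End K V} {m M : ℕ} (h : NoMiddleBlocks b m M)
    {j : ℕ} (hm : m ≤ j) (hM : j ≤ M) {v : V} (hv : (b ^ j) v = 0) :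
    ∃ v₀ u, (b ^ m) v₀ = 0 ∧ v = v₀ + (b ^ (M - j)) u := by
  have h1 : (b ^ m) v ∈ LinearMap.range (b ^ (M - (j - m))) := by
    apply h.ker_pow_inf_range_le (by omega)
    refine ⟨?_, ⟨v, rfl⟩⟩
    change (b ^ (j - m)) _ = 0
    rw [← Module.End.mul_apply, ← pow_add, Nat.sub_add_cancel hm, hv]
  obtain ⟨u, hu⟩ := h1
  refine ⟨v - (b ^ (M - j)) u, u, ?_, by simp⟩
  rw [map_sub, ← hu, ← Module.End.mul_apply, ← pow_add, sub_eq_zero]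
  congr 2; omega

/-- The drop in rank from `b ^ j` to `b ^ (j + 1)` is the dimension of `ker b ⊓ range (b ^ j)`, a
decreasing family; equal drops at `m` and `M - 1` make the two subspaces equal. -/
theorem noMiddleBlocks_of_finrank [FiniteDimensional K V] {b : End K V} {m M : ℕ} (hmM : m < M)
    (h : finrank K (LinearMap.range (b ^ m)) + finrank K (LinearMap.range (b ^ M)) ≤
      finrank K (LinearMap.range (b ^ (m + 1))) + finrank K (LinearMap.range (b ^ (M - 1)))) :
    NoMiddleBlocks b m M := by
  have h1 := finrank_range_pow_succ_add b m
  have h2 := finrank_range_pow_succ_add b (M - 1)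
  rw [Nat.sub_add_cancel (by omega : 1 ≤ M)] at h2
  have hle : (LinearMap.ker b ⊓ LinearMap.range (b ^ (M - 1)) : Submodule K V) ≤
      LinearMap.ker b ⊓ LinearMap.range (b ^ m) :=
    inf_le_inf le_rfl (range_pow_antitone b (by omega))
  have heq := Submodule.eq_of_le_of_finrank_le hle (by omega)
  unfold NoMiddleBlocks
  rw [← heq]
  exact inf_le_right

/-- A short exact sequence `0 → W → V → Q → 0` of vector spaces with endomorphisms. -/
structure ExactTriple (i : W →ₗ[K] V) (π : V →ₗ[K] Q) (a : End K W) (b : End K V)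
    (c : End K Q) : Prop where
  inj : Function.Injective i
  surj : Function.Surjective π
  exact : ∀ v, π v = 0 ↔ v ∈ LinearMap.range i
  comm_left : ∀ w, i (a w) = b (i w)
  comm_right : ∀ v, π (b v) = c (π v)

namespace ExactTriple

variable {i : W →ₗ[K] V} {π : V →ₗ[K] Q} {a : End K W} {b : End K V} {c : End K Q}

theorem pow (h : ExactTriple i π a b c) (j : ℕ) : ExactTriple i π (a ^ j) (b ^ j) (c ^ j) where
  inj := h.inj
  surj := h.surj
  exact := h.exact
  comm_left := by
    induction j with
    | zero => simp
    | succ j ih => intro w; simp only [pow_succ', Module.End.mul_apply, h.comm_left, ih]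
  comm_right := by
    induction j with
    | zero => simp
    | succ j ih => intro w; simp only [pow_succ', Module.End.mul_apply, h.comm_right, ih]

/-- Every element of the range of `b` that lies in `W` comes from the range of `a`; equivalently
the ranks of `a` and `c` add up to that of `b`. -/
def Strict (_h : ExactTriple i π a b c) : Prop :=
  ∀ v, π (b v) = 0 → ∃ w, b v = i (a w)

theorem finrank_aux [FiniteDimensional K V] (h : ExactTriple i π a b c) :
    finrank K (LinearMap.range c) +
        finrank K (LinearMap.ker π ⊓ LinearMap.range b : Submodule K V) =
        finrank K (LinearMap.range b) ∧
      (LinearMap.range a).map i ≤ LinearMap.ker π ⊓ LinearMap.range b ∧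
      finrank K ((LinearMap.range a).map i) = finrank K (LinearMap.range a) := by
  refine ⟨?_, ?_, (Submodule.equivMapOfInjective i h.inj _).finrank_eq.symm⟩
  · rw [← finrank_map_add_finrank_ker_inf π (LinearMap.range b)]
    suffices hc : LinearMap.range c = (LinearMap.range b).map π by rw [hc]
    ext q
    constructor
    · rintro ⟨q, rfl⟩
      obtain ⟨v, rfl⟩ := h.surj q
      exact ⟨b v, ⟨v, rfl⟩, h.comm_right v⟩
    · rintro ⟨_, ⟨v, rfl⟩, rfl⟩
      exact ⟨π v, (h.comm_right v).symm⟩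
  · rintro _ ⟨_, ⟨w, rfl⟩, rfl⟩
    exact ⟨(h.exact _).2 ⟨_, rfl⟩, ⟨i w, (h.comm_left w).symm⟩⟩

theorem finrank_add_le [FiniteDimensional K V] (h : ExactTriple i π a b c) :
    finrank K (LinearMap.range a) + finrank K (LinearMap.range c) ≤
      finrank K (LinearMap.range b) := by
  obtain ⟨h1, h2, h3⟩ := h.finrank_aux
  have := Submodule.finrank_mono h2
  omega

/-- The image of `range a` lies in `ker π ⊓ range b`, whose dimension is the rank of `b` minus that
of `c`; strictness is equality of the two. -/
theorem strict_iff [FiniteDimensional K V] (h : ExactTriple i π a b c) :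
    h.Strict ↔ finrank K (LinearMap.range b) ≤
      finrank K (LinearMap.range a) + finrank K (LinearMap.range c) := by
  obtain ⟨h1, h2, h3⟩ := h.finrank_aux
  constructor
  · intro hs
    have : LinearMap.ker π ⊓ LinearMap.range b ≤ (LinearMap.range a).map i := by
      rintro _ ⟨hv, ⟨v, rfl⟩⟩
      obtain ⟨w, hw⟩ := hs v hv
      exact ⟨a w, ⟨w, rfl⟩, hw.symm⟩
    have := Submodule.finrank_mono this
    omega
  · intro hle v hv
    have heq := Submodule.eq_of_le_of_finrank_le h2 (by omega)
    have hmem : b v ∈ (LinearMap.range a).map i := heq ▸ ⟨hv, ⟨v, rfl⟩⟩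
    obtain ⟨_, ⟨w, rfl⟩, hw⟩ := hmem
    exact ⟨w, hw.symm⟩

/-- Strictness at `m` and at `M` gives two approximations `a ^ m w₁` and `a ^ j w₂` to the wanted
element. Their difference lies in the range of `a ^ m` and is killed by `a ^ (M - j)`, so the gap in
the blocks of `a` puts it in the range of `a ^ j`. -/
theorem strict_of_noMiddleBlocks_left (h : ExactTriple i π a b c) {m M j : ℕ}
    (ha : NoMiddleBlocks a m M) (hm : (h.pow m).Strict) (hM : (h.pow M).Strict)
    (hmj : m ≤ j) (hjM : j ≤ M) : (h.pow j).Strict := by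
  intro v hv
  have e1 : (b ^ j) v = (b ^ m) ((b ^ (j - m)) v) := by
    rw [← Module.End.mul_apply, ← pow_add, Nat.add_sub_cancel' hmj]
  have e2 : (b ^ M) v = (b ^ (M - j)) ((b ^ j) v) := by
    rw [← Module.End.mul_apply, ← pow_add, Nat.sub_add_cancel hjM]
  obtain ⟨w₁, hw₁⟩ := hm ((b ^ (j - m)) v) (by rw [← e1, hv])
  obtain ⟨w₂, hw₂⟩ := hM v (by rw [e2, (h.pow (M - j)).comm_right, hv, map_zero])
  rw [← e1] at hw₁
  have hk : (a ^ (M - j)) ((a ^ m) w₁ - (a ^ j) w₂) = 0 := by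
    apply h.inj
    rw [(h.pow (M - j)).comm_left, map_sub, map_sub, ← hw₁, ← e2, hw₂, ← (h.pow (M - j)).comm_left,
      ← Module.End.mul_apply, ← pow_add, Nat.sub_add_cancel hjM, sub_self, map_zero]
  have hmem : (a ^ m) w₁ - (a ^ j) w₂ ∈ LinearMap.range (a ^ (M - (M - j))) := by
    apply ha.ker_pow_inf_range_le (by omega)
    exact ⟨hk, Submodule.sub_mem _ ⟨w₁, rfl⟩ (range_pow_antitone a hmj ⟨w₂, rfl⟩)⟩
  rw [Nat.sub_sub_self hjM] at hmem
  obtain ⟨w₃, hw₃⟩ := hmem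
  refine ⟨w₃ + w₂, ?_⟩
  rw [map_add, hw₃, sub_add_cancel, hw₁]

/-- The gap in the blocks of `c` splits `π v` into a part killed by `c ^ m` and a part in the range
of `c ^ (M - j)`. Lifting both, strictness at `m` handles the first and strictness at `M` the
second. -/
theorem strict_of_noMiddleBlocks_right (h : ExactTriple i π a b c) {m M j : ℕ}
    (hc : NoMiddleBlocks c m M) (hm : (h.pow m).Strict) (hM : (h.pow M).Strict)
    (hmj : m ≤ j) (hjM : j ≤ M) : (h.pow j).Strict := by
  intro v hv
  obtain ⟨q₀, q₁, hq₀, hq⟩ :=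
    hc.exists_decomposition hmj hjM (v := π v) (by rw [← (h.pow j).comm_right, hv])
  obtain ⟨v₀, rfl⟩ := h.surj q₀
  obtain ⟨v₁, rfl⟩ := h.surj q₁
  obtain ⟨w₀, hw₀⟩ := hm v₀ (by rw [(h.pow m).comm_right, hq₀])
  obtain ⟨w, hw⟩ := (h.exact (v - v₀ - (b ^ (M - j)) v₁)).1 (by
    rw [map_sub, map_sub, (h.pow (M - j)).comm_right, hq]; abel)
  have e0 : (b ^ j) v₀ = i ((a ^ j) w₀) := by
    have e (x : V) : (b ^ j) x = (b ^ (j - m)) ((b ^ m) x) := by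
      rw [← Module.End.mul_apply, ← pow_add, Nat.sub_add_cancel hmj]
    rw [e, hw₀, (h.pow m).comm_left, ← e, (h.pow j).comm_left]
  have e1 : (b ^ j) ((b ^ (M - j)) v₁) = (b ^ M) v₁ := by
    rw [← Module.End.mul_apply, ← pow_add, Nat.add_sub_cancel' hjM]
  have e2 : (b ^ j) v = (b ^ j) v₀ + (b ^ M) v₁ + i ((a ^ j) w) := by
    rw [(h.pow j).comm_left, hw, ← e1]; simp
  have hπi (w : W) : π (i w) = 0 := (h.exact _).2 ⟨w, rfl⟩
  obtain ⟨w₂, hw₂⟩ := hM v₁ (by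
    rw [e2, e0, map_add, map_add, hπi, hπi] at hv; simpa using hv)
  refine ⟨w₀ + (a ^ (M - j)) w₂ + w, ?_⟩
  rw [e2, e0, hw₂, map_add, map_add, map_add, map_add, ← Module.End.mul_apply (a ^ j), ← pow_add,
    Nat.add_sub_cancel' hjM]

end ExactTriple

end LinearAlgebra

/-! ### Skew-symmetric matrices and semicontinuity of rank. -/

section MatrixRank

variable {K : Type*} [Field K] {ι : Type*} [Fintype ι] [DecidableEq ι]

/-- The row operations that bring `A` to rank normal form, applied as a congruence, leave a skew
matrix with zero lower rows. Its only nonzero block is an invertible skew matrix of size `A.rank`,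
and the determinant forces this size to be even. -/
theorem even_rank_of_transpose_eq_neg (h2 : (2 : K) ≠ 0) {A : Matrix ι ι K} (hA : Aᵀ = -A) :
    Even A.rank := by
  obtain ⟨V, U, e, hV, hU, h⟩ := Matrix.exists_rank_normal_form A
  obtain ⟨U, rfl⟩ := hU
  have hR : IsUnit (((U⁻¹ : (Matrix ι ι K)ˣ) : Matrix ι ι K) * Vᵀ) :=
    (Units.isUnit _).mul ((Matrix.isUnit_transpose V).2 hV)
  set R : Matrix ι ι K := ((U⁻¹ : (Matrix ι ι K)ˣ) : Matrix ι ι K) * Vᵀ with hRdef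
  have hS : (V * A * Vᵀ).submatrix e.symm e.symm =
      Matrix.fromBlocks 1 0 0 0 * R.submatrix e.symm e.symm := by
    have h1 : V * A * Vᵀ = V * A * (U : Matrix ι ι K) * R := by
      rw [hRdef, Matrix.mul_assoc (V * A), ← Matrix.mul_assoc (U : Matrix ι ι K), Units.mul_inv,
        Matrix.one_mul]
    rw [h1, h, ← Matrix.submatrix_mul_equiv _ _ e.symm e.symm e.symm]
    simp [Matrix.submatrix_submatrix]
  have hskew : ((V * A * Vᵀ).submatrix e.symm e.symm)ᵀ =
      -((V * A * Vᵀ).submatrix e.symm e.symm) := by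
    rw [Matrix.transpose_submatrix]
    simp [Matrix.transpose_mul, hA, Matrix.mul_assoc, Matrix.submatrix_neg]
  have hdet : IsUnit (R.submatrix e.symm e.symm).det := by
    rw [Matrix.det_submatrix_equiv_self]
    exact (Matrix.isUnit_iff_isUnit_det _).1 hR
  rw [hS] at hskew
  rw [← Matrix.fromBlocks_toBlocks (R.submatrix e.symm e.symm)] at hskew hdet
  set a := (R.submatrix e.symm e.symm).toBlocks₁₁
  set b := (R.submatrix e.symm e.symm).toBlocks₁₂
  simp only [Matrix.fromBlocks_multiply, Matrix.fromBlocks_transpose, Matrix.fromBlocks_neg,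
    Matrix.fromBlocks_inj, Matrix.one_mul, Matrix.zero_mul, add_zero, neg_zero] at hskew
  obtain ⟨ha, hb, -, -⟩ := hskew
  have hb : b = 0 := by simpa using hb.symm
  rw [hb, Matrix.det_fromBlocks_zero₁₂] at hdet
  have hda : a.det ≠ 0 := (isUnit_of_mul_isUnit_left hdet).ne_zero
  by_contra hodd
  have h1 := congrArg Matrix.det ha
  rw [Matrix.det_transpose, Matrix.det_neg, Fintype.card_fin,
    (Nat.not_even_iff_odd.1 hodd).neg_one_pow] at h1
  have h3 : (2 : K) * a.det = 0 := by linear_combination h1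
  exact (mul_ne_zero h2 hda) h3

theorem rank_eval_zero_le [Infinite K] (P : Matrix ι ι (Polynomial K)) (k : ℕ)
    (h : ∀ t : Kˣ, (P.map (Polynomial.eval (t : K))).rank ≤ k) :
    (P.map (Polynomial.eval 0)).rank ≤ k := by
  obtain ⟨V, U, e, hV, hU, hn⟩ := Matrix.exists_rank_normal_form (P.map (Polynomial.eval 0))
  set f : Fin (P.map (Polynomial.eval 0)).rank → ι := fun a => e.symm (Sum.inl a)
  set R : Matrix ι ι (Polynomial K) := V.map Polynomial.C * P * U.map Polynomial.C
  have hR (t : K) : R.map (Polynomial.eval t) = V * P.map (Polynomial.eval t) * U := by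
    have := fun (A B : Matrix ι ι (Polynomial K)) =>
      Matrix.map_mul (L := A) (M := B) (f := Polynomial.evalRingHom t)
    simp only [Polynomial.coe_evalRingHom] at this
    simp only [R, this]
    congr 1
    · congr 1; ext; simp
    · ext; simp
  set d := (R.submatrix f f).det
  have hd (t : K) : d.eval t = ((V * P.map (Polynomial.eval t) * U).submatrix f f).det := by
    rw [← hR]
    exact RingHom.map_det (Polynomial.evalRingHom t) _
  have hd0 : d.eval 0 = 1 := by
    rw [hd, hn]
    convert Matrix.det_one (n := Fin (P.map (Polynomial.eval 0)).rank) (R := K) using 2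
    ext a b
    rcases eq_or_ne a b with rfl | hab <;> simp [f, *]
  -- The factor `X` makes the point where the minor survives a unit.
  obtain ⟨t, ht⟩ : ∃ t, (Polynomial.X * d).eval t ≠ 0 := by
    by_contra! hc
    have : Polynomial.X * d = 0 := Polynomial.funext (by simpa using hc)
    rcases mul_eq_zero.1 this with h | h
    · exact Polynomial.X_ne_zero h
    · rw [h] at hd0; simp at hd0
  rw [Polynomial.eval_mul, Polynomial.eval_X] at ht
  have ht0 : t ≠ 0 := left_ne_zero_of_mul ht
  have hdt := right_ne_zero_of_mul ht
  rw [hd] at hdt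
  calc _ = ((V * P.map (Polynomial.eval t) * U).submatrix f f).rank := by
        rw [Matrix.rank_of_isUnit _ ((Matrix.isUnit_iff_isUnit_det _).2 hdt.isUnit),
          Fintype.card_fin]
    _ ≤ (V * P.map (Polynomial.eval t) * U).rank := Matrix.rank_submatrix_le _ _ _
    _ ≤ (P.map (Polynomial.eval t)).rank :=
        (Matrix.rank_mul_le_left _ _).trans (Matrix.rank_mul_le_right _ _)
    _ ≤ k := h (Units.mk0 t ht0)

end MatrixRank

/-! ### Excess functions of partitions and the dominance order. -/

section Excess

/-- The number of cells of the Young diagram with parts `A` outside the first `j` columns. -/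
def excess (A : Multiset ℕ) (j : ℕ) : ℕ := (A.map (fun a => a - j)).sum

@[simp]
theorem excess_add (A B : Multiset ℕ) (j : ℕ) : excess (A + B) j = excess A j + excess B j := by
  simp [excess]

@[simp]
theorem excess_cons (a : ℕ) (B : Multiset ℕ) (j : ℕ) :
    excess (a ::ₘ B) j = (a - j) + excess B j := by
  simp [excess]

@[simp]
theorem excess_singleton (a j : ℕ) : excess {a} j = a - j := by
  simp [excess]

@[simp]
theorem excess_zero_left (j : ℕ) : excess 0 j = 0 := rfl

theorem excess_zero_right (A : Multiset ℕ) : excess A 0 = A.sum := by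
  simp [excess]

theorem excess_filter_ne_zero (A : Multiset ℕ) (j : ℕ) :
    excess (A.filter (fun a => a ≠ 0)) j = excess A j := by
  induction A using Multiset.induction with
  | empty => simp
  | cons a A ih =>
    by_cases ha : a = 0
    · rw [Multiset.filter_cons_of_neg (p := fun a => a ≠ 0) A (not_not.2 ha), ih]; simp [ha]
    · rw [Multiset.filter_cons_of_pos (p := fun a => a ≠ 0) A ha, excess_cons, ih, excess_cons]

theorem excess_add_excess (A : Multiset ℕ) (j : ℕ) :
    excess A j + excess A (j + 2) = 2 * excess A (j + 1) + A.count (j + 1) := by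
  induction A using Multiset.induction with
  | empty => simp
  | cons a A ih =>
    simp only [excess_cons, Multiset.count_cons]
    split_ifs <;> omega

theorem excess_eq_zero {A : Multiset ℕ} {j : ℕ} (h : A.sum ≤ j) : excess A j = 0 := by
  refine Multiset.sum_eq_zero fun b hb => ?_
  obtain ⟨a, ha, rfl⟩ := Multiset.mem_map.1 hb
  exact Nat.sub_eq_zero_of_le ((Multiset.single_le_sum (by simp) a ha).trans h)

theorem sum_take_le_excess (l : List ℕ) (k j : ℕ) :
    (l.take k).sum ≤ k * j + (l.map (fun a => a - j)).sum := by
  induction l generalizing k with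
  | nil => simp
  | cons a l ih =>
    cases k with
    | zero => simp
    | succ k =>
      have := ih k
      simp only [List.take_succ_cons, List.sum_cons, List.map_cons, add_mul]
      omega

theorem exists_sum_take_eq_excess (l : List ℕ) (hl : l.Pairwise (fun a b => b ≤ a)) (k : ℕ) :
    ∃ j, (l.take k).sum = k * j + (l.map (fun a => a - j)).sum := by
  induction l generalizing k with
  | nil => exact ⟨0, by simp⟩
  | cons a l ih =>
    obtain ⟨h1, h2⟩ := List.pairwise_cons.1 hl
    cases k with
    | zero =>
      refine ⟨a, ?_⟩
      have : (l.map (fun b => b - a)).sum = 0 := by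
        refine List.sum_eq_zero fun b hb => ?_
        obtain ⟨c, hc, rfl⟩ := List.mem_map.1 hb
        exact Nat.sub_eq_zero_of_le (h1 c hc)
      simp [this]
    | succ k =>
      obtain ⟨j, hj⟩ := ih h2 k
      by_cases hja : j ≤ a
      · refine ⟨j, ?_⟩
        simp only [List.take_succ_cons, List.sum_cons, List.map_cons, add_mul]
        omega
      -- The threshold `j` of the tail exceeds all parts, so the tail has no excess over `j` or over
      -- `a`, and `a` serves as well.
      · refine ⟨a, ?_⟩
        have h0 (c : ℕ) (hc : ∀ b ∈ l, b ≤ c) : (l.map (fun b => b - c)).sum = 0 := by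
          refine List.sum_eq_zero fun b hb => ?_
          obtain ⟨d, hd, rfl⟩ := List.mem_map.1 hb
          exact Nat.sub_eq_zero_of_le (hc d hd)
        rw [h0 j (fun b hb => (h1 b hb).trans (by omega))] at hj
        have hle := sum_take_le_excess l k a
        rw [h0 a h1] at hle
        simp only [List.take_succ_cons, List.sum_cons, List.map_cons, add_mul, h0 a h1, hj]
        have : k * a ≤ k * j := Nat.mul_le_mul_left k (by omega)
        omega

/-- The `k`-th partial sum is the minimum over `j` of `k * j + excess j`: the previous two lemmas
give the bound and its attainment. -/
theorem dominates_of_excess_le {N : ℕ} {p q : Nat.Partition N}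
    (h : ∀ j, excess q.parts j ≤ excess p.parts j) : Dominates p q := by
  intro k
  have e (p : Nat.Partition N) (j : ℕ) : excess p.parts j =
      ((p.parts.sort (fun a b => b ≤ a)).map (fun a => a - j)).sum := by
    rw [← Multiset.sum_coe, ← Multiset.map_coe, Multiset.sort_eq]; rfl
  obtain ⟨j, hj⟩ := exists_sum_take_eq_excess (p.parts.sort (fun a b => b ≤ a))
    (Multiset.pairwise_sort _ _) k
  have h1 := sum_take_le_excess (q.parts.sort (fun a b => b ≤ a)) k j
  have h2 := h j
  rw [e, e] at h2
  unfold partialSum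
  omega

/-- A convex function vanishing from `N` on is the excess function of a partition. -/
theorem exists_excess_eq (f : ℕ → ℕ) (N : ℕ) (hconv : ∀ j, 2 * f (j + 1) ≤ f j + f (j + 2))
    (hN : ∀ j, N ≤ j → f j = 0) : ∃ A : Multiset ℕ, ∀ j, excess A j = f j := by
  set A : Multiset ℕ := ∑ k ∈ Finset.range N,
    Multiset.replicate (f k + f (k + 2) - 2 * f (k + 1)) (k + 1) with hA
  have hcount (k : ℕ) (hk : k < N) : A.count (k + 1) = f k + f (k + 2) - 2 * f (k + 1) := by
    rw [hA, Multiset.count_sum', Finset.sum_eq_single k]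
    · simp
    · intro b _ hb
      rw [Multiset.count_replicate, if_neg (by omega)]
    · intro h; exact absurd (Finset.mem_range.2 hk) h
  have hbound : ∀ a ∈ A, a ≤ N := by
    intro a ha
    obtain ⟨k, hk, hak⟩ := Multiset.mem_sum.1 ha
    rw [Multiset.eq_of_mem_replicate hak]
    exact Finset.mem_range.1 hk
  have hzero (j : ℕ) (hj : N ≤ j) : excess A j = 0 := by
    refine Multiset.sum_eq_zero fun b hb => ?_
    obtain ⟨a, ha, rfl⟩ := Multiset.mem_map.1 hb
    exact Nat.sub_eq_zero_of_le ((hbound a ha).trans hj)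
  refine ⟨A, ?_⟩
  suffices h : ∀ d j, N ≤ j + d → excess A j = f j from fun j => h N j (by omega)
  intro d
  induction d using Nat.strong_induction_on with
  | _ d ih =>
    intro j hj
    by_cases hjN : N ≤ j
    · rw [hzero j hjN, hN j hjN]
    have e1 : excess A (j + 1) = f (j + 1) := ih (d - 1) (by omega) _ (by omega)
    have e2 : excess A (j + 2) = f (j + 2) := ih (d - 1) (by omega) _ (by omega)
    have h1 := excess_add_excess A j
    have h2 := hconv j
    rw [e1, e2, hcount j (by omega)] at h1
    omega

/-- The multiplicity of an odd part is a second difference centred at an odd degree, so modulo two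
it is a sum of two excesses in even degrees. -/
theorem isSymplecticPartition_of_excess {N : ℕ} {p : Nat.Partition N}
    (heven : ∀ j, Even (excess p.parts (2 * j))) : IsSymplecticPartition p := by
  rintro a - ⟨b, rfl⟩
  have h1 := excess_add_excess p.parts (2 * b)
  have h4 := (heven b).add (heven (b + 1))
  rw [show 2 * (b + 1) = 2 * b + 2 by ring, h1, Nat.even_add] at h4
  exact h4.1 (even_two_mul _)

theorem exists_partition_excess_eq {N : ℕ} (f : ℕ → ℕ) (h0 : f 0 = N)
    (hconv : ∀ j, 2 * f (j + 1) ≤ f j + f (j + 2)) (hN : ∃ M, ∀ j, M ≤ j → f j = 0)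
    (heven : ∀ j, Even (f (2 * j))) :
    ∃ m : Nat.Partition N, IsSymplecticPartition m ∧ ∀ j, excess m.parts j = f j := by
  obtain ⟨M, hM⟩ := hN
  obtain ⟨A, hA⟩ := exists_excess_eq f M hconv hM
  have hsum : A.sum = N := by rw [← excess_zero_right, hA, h0]
  have hm (j : ℕ) : excess (Nat.Partition.ofSums N A hsum).parts j = f j :=
    (excess_filter_ne_zero A j).trans (hA j)
  exact ⟨Nat.Partition.ofSums N A hsum,
    isSymplecticPartition_of_excess fun j => by rw [hm]; exact heven j, hm⟩

end Excess

/-! ### Ranks of powers from the Jordan type. -/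

section JordanType

variable {κ m : Type*} [Field κ] [Fintype m] [DecidableEq m]

/-- `x ^ j` moves each chain down by `j`, so its image has as basis the lowest `d i - j` vectors of
each chain. -/
theorem rank_pow_of_hasJordanType {x : Matrix m m κ} {π : Multiset ℕ} (h : HasJordanType x π)
    (j : ℕ) : (x ^ j).rank = excess π j := by
  obtain ⟨k, d, b, rfl, h0, h1⟩ := h
  have hA (j : ℕ) : ∀ (i : Fin k) (l : ℕ) (h : l + j < d i),
      (x ^ j) *ᵥ b ⟨i, ⟨l + j, h⟩⟩ = b ⟨i, ⟨l, (Nat.le_add_right l j).trans_lt h⟩⟩ := by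
    induction j with
    | zero => intro i l h; simp
    | succ j ih =>
      intro i l h
      rw [pow_succ, ← Matrix.mulVec_mulVec]
      exact (congrArg _ (h1 i (l + j) h)).trans (ih i l _)
  have hB (j : ℕ) : ∀ (i : Fin k) (l : ℕ) (h : l < d i), l < j →
      (x ^ j) *ᵥ b ⟨i, ⟨l, h⟩⟩ = 0 := by
    induction j with
    | zero => intro i l h hl; omega
    | succ j ih =>
      intro i l h hl
      rw [pow_succ, ← Matrix.mulVec_mulVec]
      cases l with
      | zero => rw [h0, Matrix.mulVec_zero]
      | succ l => rw [h1]; exact ih i l _ (by omega)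
  set e : (Σ i : Fin k, Fin (d i - j)) → Σ i : Fin k, Fin (d i) :=
    fun a => ⟨a.1, ⟨a.2, a.2.2.trans_le (Nat.sub_le _ _)⟩⟩ with he
  have hinj : Function.Injective e := by
    rintro ⟨i, l⟩ ⟨i', l'⟩ h
    simp only [he, Sigma.mk.injEq] at h
    obtain ⟨rfl, h⟩ := h
    simp only [heq_eq_eq, Fin.mk.injEq] at h
    rw [Fin.ext h]
  have hrange : LinearMap.range (x ^ j).mulVecLin = Submodule.span κ (Set.range (b ∘ e)) := by
    rw [LinearMap.range_eq_map, ← b.span_eq, Submodule.map_span]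
    apply le_antisymm
    · rw [Submodule.span_le]
      rintro _ ⟨_, ⟨⟨i, l, hl⟩, rfl⟩, rfl⟩
      rw [SetLike.mem_coe, Matrix.mulVecLin_apply]
      by_cases hlj : l < j
      · rw [hB j i l hl hlj]; exact Submodule.zero_mem _
      · obtain ⟨u, rfl⟩ := Nat.exists_eq_add_of_le' (not_lt.1 hlj)
        rw [hA j i u hl]
        exact Submodule.subset_span ⟨⟨i, ⟨u, by omega⟩⟩, rfl⟩
    · apply Submodule.span_mono
      rintro _ ⟨⟨i, l, hl⟩, rfl⟩
      exact ⟨_, ⟨⟨i, ⟨l + j, by omega⟩⟩, rfl⟩, by rw [Matrix.mulVecLin_apply, hA]; rfl⟩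
  rw [Matrix.rank, hrange, finrank_span_eq_card (b.linearIndependent.comp e hinj)]
  simp [excess, List.sum_ofFn]

end JordanType

/-! ### Consequences of adjacency for the parts between `2s` and `2r`. -/

section Adjacency

variable {n r s : ℕ} {C : Multiset ℕ} {p q : Nat.Partition (2 * n)}

theorem excess_upper
    (hp : p.parts = C + ({2 * r, 2 * s} : Multiset ℕ).filter (fun a => a ≠ 0)) (j : ℕ) :
    excess p.parts j = excess C j + ((2 * r - j) + (2 * s - j)) := by
  rw [hp, excess_add, excess_filter_ne_zero]
  simp

theorem excess_lower (hq : q.parts = C + {2 * r - 2, 2 * s + 2}) (j : ℕ) :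
    excess q.parts j = excess C j + ((2 * r - 2 - j) + (2 * s + 2 - j)) := by
  rw [hq, excess_add]
  simp

/-- A multiset of parts squeezed between two adjacent symplectic partitions is one of them. -/
theorem AdjacentBelow.excess_eq_or (hadj : AdjacentBelow q p) {m : Nat.Partition (2 * n)}
    (hm : IsSymplecticPartition m) (hq : ∀ j, excess q.parts j ≤ excess m.parts j)
    (hp : ∀ j, excess m.parts j ≤ excess p.parts j) :
    (∀ j, excess m.parts j = excess p.parts j) ∨ (∀ j, excess m.parts j = excess q.parts j) := by
  rcases hadj.2.2 m hm (dominates_of_excess_le hp) (dominates_of_excess_le hq) with rfl | rfl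
  · exact Or.inl fun _ => rfl
  · exact Or.inr fun _ => rfl

theorem AdjacentBelow.excess_eq_or_of_multiset (hadj : AdjacentBelow q p) {A : Multiset ℕ}
    (hA : ∀ a, Odd a → Even (A.count a)) (hq : ∀ j, excess q.parts j ≤ excess A j)
    (hp : ∀ j, excess A j ≤ excess p.parts j) :
    (∀ j, excess A j = excess p.parts j) ∨ (∀ j, excess A j = excess q.parts j) := by
  have hsum : A.sum = 2 * n := by
    have h1 := hp 0
    have h2 := hq 0
    rw [excess_zero_right, excess_zero_right, Nat.Partition.parts_sum] at h1 h2
    omega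
  have he (j : ℕ) : excess (Nat.Partition.ofSums _ A hsum).parts j = excess A j :=
    excess_filter_ne_zero A j
  simp only [← he] at hp hq ⊢
  refine hadj.excess_eq_or (fun a _ ha => ?_) hq hp
  rw [Nat.Partition.count_ofSums_of_ne_zero _ ha.pos.ne']
  exact hA a ha

theorem count_triple_eq_zero_of_even {a b c d : ℕ} (ha : Odd a) (hb : Even b) (hc : Even c)
    (hd : Even d) : Multiset.count a {b, c, d} = 0 := by
  have h (e : ℕ) (he : Even e) : a ≠ e := by
    rintro rfl; exact Nat.not_even_iff_odd.2 ha he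
  simp [h b hb, h c hc, h d hd]

/-- A further part `c` would allow a symplectic partition strictly between. For even `c`, replace
`(2r, c, 2s)` by `(2r, c - 2, 2s + 2)`, or by `(2r - 2, 2s + 4, 2s)` if `c = 2s + 2`; the latter
differs from `p` because `2r ≥ 2s + 6`. An odd `c` occurs twice; replace `(2r, c, c, 2s)` by `(2r, c
- 1, c - 1, 2s + 2)`, or by `(2r - 2, 2s + 2, 2s + 2, 2s)` if `c = 2s + 1`. In each case a single
degree of the excess tells the new partition from `p` and another from `q`. -/
theorem not_mem_of_adjacentBelow (hrs : 2 * s + 6 ≤ 2 * r)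
    (hp : p.parts = C + ({2 * r, 2 * s} : Multiset ℕ).filter (fun a => a ≠ 0))
    (hq : q.parts = C + {2 * r - 2, 2 * s + 2})
    (hadj : AdjacentBelow q p) (hsp : IsSymplecticPartition p) {c : ℕ} (hcs : 2 * s < c)
    (hcr : c < 2 * r) : c ∉ C := by
  intro hc
  have hCodd (a : ℕ) (ha : Odd a) : Even (C.count a) := by
    by_cases haC : a ∈ C
    · have h := hsp a (by rw [hp]; exact Multiset.mem_add.2 (Or.inl haC)) ha
      have h0 : a ∉ ({2 * r, 2 * s} : Multiset ℕ).filter (fun a => a ≠ 0) := by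
        rw [Multiset.mem_filter]
        rintro ⟨h, -⟩
        obtain ⟨b, rfl⟩ := ha
        rcases Multiset.mem_cons.1 h with h | h
        · omega
        · have := Multiset.mem_singleton.1 h; omega
      rwa [hp, Multiset.count_add, Multiset.count_eq_zero_of_notMem h0] at h
    · rw [Multiset.count_eq_zero_of_notMem haC]; exact Even.zero
  have hpe := excess_upper hp
  have hqe := excess_lower hq
  obtain ⟨C', rfl⟩ := Multiset.exists_cons_of_mem hc
  rcases Nat.even_or_odd c with hce | hco
  · have hodd (a : ℕ) (ha : Odd a) : Even (C'.count a) := by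
      have := hCodd a ha
      rwa [Multiset.count_cons_of_ne] at this
      rintro rfl; exact Nat.not_even_iff_odd.2 ha hce
    obtain ⟨t, rfl⟩ := hce
    by_cases ht : t + t = 2 * s + 2
    · rcases hadj.excess_eq_or_of_multiset (A := C' + {2 * r - 2, 2 * s + 4, 2 * s})
        (fun a ha => by
          rw [Multiset.count_add, count_triple_eq_zero_of_even ha ⟨r - 1, by omega⟩
            ⟨s + 2, by omega⟩ ⟨s, by omega⟩]
          exact hodd a ha)
        (fun j => by simp [hqe]; omega) (fun j => by simp [hpe]; omega) with h | h
      · have := h (2 * r - 1); simp [hpe] at this; omega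
      · have := h (2 * s + 2); simp [hqe] at this; omega
    · rcases hadj.excess_eq_or_of_multiset (A := C' + {2 * r, t + t - 2, 2 * s + 2})
        (fun a ha => by
          rw [Multiset.count_add, count_triple_eq_zero_of_even ha ⟨r, by omega⟩
            ⟨t - 1, by omega⟩ ⟨s + 1, by omega⟩]
          exact hodd a ha)
        (fun j => by simp [hqe]; omega) (fun j => by simp [hpe]; omega) with h | h
      · have := h (t + t - 1); simp [hpe] at this; omega
      · have := h (2 * r - 1); simp [hqe] at this; omega
  · have hc' : c ∈ C' := by
      have := hCodd c hco
      rw [Multiset.count_cons_self] at this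
      by_contra hn
      rw [Multiset.count_eq_zero_of_notMem hn] at this
      simp at this
    obtain ⟨D, rfl⟩ := Multiset.exists_cons_of_mem hc'
    have hodd (a : ℕ) (ha : Odd a) : Even (D.count a) := by
      have := hCodd a ha
      simp only [Multiset.count_cons] at this
      split_ifs at this
      · rwa [add_assoc, Nat.even_add, iff_true_right (by decide)] at this
      · simpa using this
    obtain ⟨t, rfl⟩ := hco
    by_cases ht : t = s
    · subst ht
      rcases hadj.excess_eq_or_of_multiset
        (A := (2 * t + 2) ::ₘ (D + {2 * r - 2, 2 * t + 2, 2 * t}))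
        (fun a ha => by
          rw [Multiset.count_cons_of_ne (by rintro rfl; exact absurd ha (by simp [parity_simps])),
            Multiset.count_add, count_triple_eq_zero_of_even ha ⟨r - 1, by omega⟩
            ⟨t + 1, by omega⟩ ⟨t, by omega⟩]
          exact hodd a ha)
        (fun j => by simp [hqe]; omega) (fun j => by simp [hpe]; omega) with h | h
      · have := h (2 * r - 1); simp [hpe] at this; omega
      · have := h (2 * t + 1); simp [hqe] at this; omega
    · rcases hadj.excess_eq_or_of_multiset
        (A := (2 * t) ::ₘ (D + {2 * r, 2 * t, 2 * s + 2}))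
        (fun a ha => by
          rw [Multiset.count_cons_of_ne (by rintro rfl; exact absurd ha (by simp [parity_simps])),
            Multiset.count_add, count_triple_eq_zero_of_even ha ⟨r, by omega⟩
            ⟨t, by omega⟩ ⟨s + 1, by omega⟩]
          exact hodd a ha)
        (fun j => by simp [hqe]; omega) (fun j => by simp [hpe]; omega) with h | h
      · have := h (2 * t); simp [hpe] at this; omega
      · have := h (2 * r - 1); simp [hqe] at this; omega

theorem count_lower_le_one (hrs : 2 * s + 6 ≤ 2 * r) (hq : q.parts = C + {2 * r - 2, 2 * s + 2})
    {c : ℕ} (hc : c ∉ C) : q.parts.count c ≤ 1 := by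
  rw [hq, Multiset.count_add, Multiset.count_eq_zero_of_notMem hc, zero_add]
  refine Multiset.nodup_iff_count_le_one.1 ?_ c
  simp
  omega

end Adjacency

/-! ### Weight decomposition of a cocharacter. -/

section Weights

variable {κ : Type*} [Field κ]

theorem exists_unit_zpow_ne_one [Infinite κ] {m : ℤ} (hm : m ≠ 0) : ∃ t : κˣ, t ^ m ≠ 1 := by
  by_contra! h
  have h1 (t : κˣ) : t ^ m.natAbs = 1 := by
    have := h t
    rcases Int.natAbs_eq m with e | e
    · rwa [e, zpow_natCast] at this
    · rwa [e, zpow_neg, zpow_natCast, inv_eq_one] at this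
  have h2 : (Polynomial.X * (Polynomial.X ^ m.natAbs - 1) : Polynomial κ) = 0 := by
    refine Polynomial.funext fun a => ?_
    by_cases ha : a = 0
    · simp [ha]
    · have := congrArg Units.val (h1 (Units.mk0 a ha))
      simp at this
      simp [this]
  rcases mul_eq_zero.1 h2 with h3 | h3
  · exact Polynomial.X_ne_zero h3
  · exact (Polynomial.monic_X_pow_sub_C (1 : κ) (Int.natAbs_ne_zero.2 hm)).ne_zero (by simpa using h3)

/-- Over an infinite field the characters `t ↦ t ^ i` are distinct, hence linearly independent. -/
theorem eq_zero_of_sum_zpow_eq_zero [Infinite κ] {S : Finset ℤ} {B : ℤ → κ}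
    (h : ∀ t : κˣ, ∑ i ∈ S, ((t ^ i : κˣ) : κ) * B i = 0) {i : ℤ} (hi : i ∈ S) : B i = 0 := by
  set χ : ℤ → (κˣ →* κ) := fun i => (Units.coeHom κ).comp (zpowGroupHom i) with hχ
  have hinj : Function.Injective χ := by
    intro i k hik
    by_contra hne
    obtain ⟨t, ht⟩ := exists_unit_zpow_ne_one (κ := κ) (sub_ne_zero.2 hne)
    apply ht
    have : t ^ i = t ^ k := Units.ext (DFunLike.congr_fun hik t)
    rw [zpow_sub, this, mul_inv_cancel]
  have hli := (linearIndependent_monoidHom κˣ κ).comp χ hinj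
  refine linearIndependent_iff'.1 hli S B ?_ i hi
  funext t
  rw [Finset.sum_apply, Pi.zero_apply, ← h t]
  refine Finset.sum_congr rfl fun i _ => ?_
  simp [hχ, mul_comm]

theorem matrix_eq_zero_of_sum_zpow_eq_zero [Infinite κ] {ι : Type*} {S : Finset ℤ}
    {B : ℤ → Matrix ι ι κ} (h : ∀ t : κˣ, ∑ i ∈ S, ((t ^ i : κˣ) : κ) • B i = 0) {i : ℤ}
    (hi : i ∈ S) : B i = 0 := by
  ext a b
  refine eq_zero_of_sum_zpow_eq_zero (S := S) (B := fun i => B i a b) (fun t => ?_) hi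
  have := congrFun (congrFun (h t) a) b
  simpa [Matrix.sum_apply] using this

theorem laurentPolynomial_eval_eq_sum (p : LaurentPolynomial κ) : ∃ a : ℤ →₀ κ, ∀ t : κˣ,
    LaurentPolynomial.eval₂ (RingHom.id κ) t p = a.sum fun i c => ((t ^ i : κˣ) : κ) * c := by
  induction p using LaurentPolynomial.induction_on' with
  | add p q hp hq =>
    obtain ⟨a, ha⟩ := hp
    obtain ⟨b, hb⟩ := hq
    refine ⟨a + b, fun t => ?_⟩
    rw [map_add, ha, hb, Finsupp.sum_add_index' (by simp) (by intros; ring)]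
  | C_mul_T k c =>
    refine ⟨Finsupp.single k c, fun t => ?_⟩
    rw [Finsupp.sum_single_index (mul_zero _), LaurentPolynomial.eval₂_C_mul_T, mul_comm]
    rfl

/-- The weight projections of a cocharacter. -/
structure IsWeightDecomposition {n : ℕ} (c : Cocharacter n κ) (N : ℕ)
    (A : ℤ → Matrix (Fin n ⊕ Fin n) (Fin n ⊕ Fin n) κ) : Prop where
  mul_self (i : ℤ) : A i * A i = A i
  mul_of_ne {i k : ℤ} (h : i ≠ k) : A i * A k = 0
  sum_eq : ∑ i ∈ Finset.Icc (-(N : ℤ)) N, A i = 1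
  mul_hom (t : κˣ) (i : ℤ) : A i * (c.toHom t).1 = ((t ^ i : κˣ) : κ) • A i
  hom_mul (t : κˣ) (i : ℤ) : (c.toHom t).1 * A i = ((t ^ i : κˣ) : κ) • A i
  transpose_mul_J (i : ℤ) : (A i)ᵀ * Matrix.J (Fin n) κ = Matrix.J (Fin n) κ * A (-i)

/-- The projections are the coefficient matrices of the Laurent polynomials giving `c`. All
relations follow by comparing coefficients in `c (t * s) = c t * c s`, `c 1 = 1` and `(c t)ᵀ * J = J
* c t⁻¹`. -/
theorem exists_isWeightDecomposition [Infinite κ] {n : ℕ} (c : Cocharacter n κ) :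
    ∃ N A, IsWeightDecomposition c N A := by
  choose p hp using c.regular
  choose a ha using fun i j => laurentPolynomial_eval_eq_sum (p i j)
  set T : Finset ℤ := Finset.univ.biUnion fun i => Finset.univ.biUnion fun j => (a i j).support
  set N : ℕ := T.sup Int.natAbs with hNdef
  set S : Finset ℤ := Finset.Icc (-(N : ℤ)) N with hS
  have hTS (i j) : (a i j).support ⊆ S := by
    intro k hk
    have : k ∈ T := Finset.mem_biUnion.2 ⟨i, Finset.mem_univ _,
      Finset.mem_biUnion.2 ⟨j, Finset.mem_univ _, hk⟩⟩
    have : k.natAbs ≤ N := Finset.le_sup (f := Int.natAbs) this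
    rw [hS, Finset.mem_Icc]; omega
  set A : ℤ → Matrix (Fin n ⊕ Fin n) (Fin n ⊕ Fin n) κ := fun k => Matrix.of fun i j => a i j k
  have hA0 (k : ℤ) (hk : k ∉ S) : A k = 0 := by
    ext i j
    exact Finsupp.notMem_support_iff.1 fun h => hk (hTS i j h)
  have hsum (t : κˣ) : (c.toHom t).1 = ∑ k ∈ S, ((t ^ k : κˣ) : κ) • A k := by
    ext i j
    rw [hp, ha, Matrix.sum_apply, Finsupp.sum_of_support_subset _ (hTS i j) _ (by simp)]
    rfl
  have hmul (s : κˣ) (k : ℤ) : A k * (c.toHom s).1 = ((s ^ k : κˣ) : κ) • A k := by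
    by_cases hk : k ∈ S
    · refine sub_eq_zero.1 (matrix_eq_zero_of_sum_zpow_eq_zero
        (B := fun k => A k * (c.toHom s).1 - ((s ^ k : κˣ) : κ) • A k) (fun t => ?_) hk)
      simp only [smul_sub, Finset.sum_sub_distrib, ← Matrix.smul_mul, ← Finset.sum_mul, smul_smul]
      rw [← hsum t, sub_eq_zero]
      have : (c.toHom (t * s)).1 = (c.toHom t).1 * (c.toHom s).1 := by rw [map_mul]; rfl
      rw [← this, hsum]
      simp [mul_zpow]
    · simp [hA0 k hk]
  have hAA (i k : ℤ) : A i * A k = if k = i then A i else 0 := by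
    by_cases hi : i ∈ S
    · by_cases hk : k ∈ S
      · refine sub_eq_zero.1 (matrix_eq_zero_of_sum_zpow_eq_zero
          (B := fun k => A i * A k - if k = i then A i else 0) (fun t => ?_) hk)
        simp only [smul_sub, Finset.sum_sub_distrib, ← Matrix.mul_smul, ← Finset.mul_sum]
        rw [← hsum t, hmul, sub_eq_zero]
        simp [hi]
      · rw [hA0 k hk, if_neg (by rintro rfl; exact hk hi), mul_zero]
    · simp [hA0 i hi]
  have hmul' (s : κˣ) (k : ℤ) : (c.toHom s).1 * A k = ((s ^ k : κˣ) : κ) • A k := by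
    rw [hsum, Finset.sum_mul]
    simp only [Matrix.smul_mul, hAA, smul_ite, smul_zero]
    by_cases hk : k ∈ S
    · simp [hk]
    · simp [hA0 k hk]
  refine ⟨N, A, fun i => by simp [hAA], fun {i k} h => by rw [hAA, if_neg h.symm], ?_, hmul, hmul',
    fun i => ?_⟩
  · have := hsum 1
    rw [map_one] at this
    simpa using this.symm
  · have hneg (k : ℤ) : -k ∈ S ↔ k ∈ S := by simp only [hS, Finset.mem_Icc]; omega
    by_cases hi : i ∈ S
    · refine sub_eq_zero.1 (matrix_eq_zero_of_sum_zpow_eq_zero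
        (B := fun i => (A i)ᵀ * Matrix.J (Fin n) κ - Matrix.J (Fin n) κ * A (-i)) (fun t => ?_) hi)
      have h1 : ∑ k ∈ S, ((t ^ k : κˣ) : κ) • A (-k) = (c.toHom t⁻¹).1 := by
        rw [hsum]
        refine Finset.sum_nbij' (fun k => -k) (fun k => -k) ?_ ?_ ?_ ?_ ?_ <;> simp [hneg]
      have h2 := SymplecticGroup.mem_iff'.1 (c.toHom t).2
      have h3 : (c.toHom t).1 * (c.toHom t⁻¹).1 = 1 := by
        have := congrArg Subtype.val (map_mul c.toHom t t⁻¹)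
        rw [mul_inv_cancel, map_one] at this
        exact this.symm
      have h4 : ∑ k ∈ S, ((t ^ k : κˣ) : κ) • ((A k)ᵀ * Matrix.J (Fin n) κ) =
          ((c.toHom t).1)ᵀ * Matrix.J (Fin n) κ := by
        simp [hsum t, Matrix.transpose_sum, Finset.sum_mul]
      have h5 : ∑ k ∈ S, ((t ^ k : κˣ) : κ) • (Matrix.J (Fin n) κ * A (-k)) =
          Matrix.J (Fin n) κ * (c.toHom t⁻¹).1 := by
        rw [← h1, Finset.mul_sum]
        simp only [Matrix.mul_smul]
      simp only [smul_sub, Finset.sum_sub_distrib]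
      rw [h4, h5, sub_eq_zero]
      calc _ = ((c.toHom t).1)ᵀ * Matrix.J (Fin n) κ * ((c.toHom t).1 * (c.toHom t⁻¹).1) := by
            rw [h3, mul_one]
        _ = _ := by rw [← mul_assoc, h2]
    · rw [hA0 i hi, hA0 (-i) (by rwa [hneg])]; simp

end Weights

/-! ### Block triangular endomorphisms and the rank comparison. -/

section Compression

variable {K V : Type*} [Field K] [AddCommGroup V] [Module K V]

/-- The compression of `x` to the range of `E`. -/
def compression (x E : End K V) : End K (LinearMap.range E) :=
  (E.rangeRestrict ∘ₗ x) ∘ₗ (LinearMap.range E).subtype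

theorem compression_apply (x E : End K V) (w : LinearMap.range E) :
    (compression x E w : V) = E (x w) := rfl

theorem apply_of_mem_range {E : End K V} (hE : E * E = E) (w : LinearMap.range E) :
    E w = w := by
  obtain ⟨_, v, rfl⟩ := w
  exact LinearMap.congr_fun hE v

theorem compression_pow_apply {x E : End K V} (hE : E * E = E) (hx : E * x * E = x * E) (j : ℕ)
    (w : LinearMap.range E) : ((compression x E ^ j) w : V) = (x ^ j) w := by
  induction j with
  | zero => rfl
  | succ j ih =>
    rw [pow_succ', pow_succ', Module.End.mul_apply, Module.End.mul_apply, compression_apply, ih]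
    have h := LinearMap.congr_fun hx ((compression x E ^ j) w : V)
    simp only [Module.End.mul_apply, apply_of_mem_range hE] at h
    rwa [ih] at h

theorem finrank_range_compression_pow {x E : End K V} (hE : E * E = E)
    (hx : E * x * E = x * E) (j : ℕ) :
    finrank K (LinearMap.range (compression x E ^ j)) = finrank K (LinearMap.range (x ^ j * E)) := by
  have h : LinearMap.range (x ^ j * E) =
      (LinearMap.range (compression x E ^ j)).map (LinearMap.range E).subtype := by
    ext v
    constructor
    · rintro ⟨u, rfl⟩
      refine ⟨_, ⟨⟨E u, u, rfl⟩, rfl⟩, ?_⟩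
      exact compression_pow_apply hE hx j _
    · rintro ⟨_, ⟨⟨_, u, rfl⟩, rfl⟩, rfl⟩
      exact ⟨u, (compression_pow_apply hE hx j ⟨E u, u, rfl⟩).symm⟩
  rw [h]
  exact (Submodule.equivMapOfInjective _ (Submodule.subtype_injective _) _).finrank_eq

theorem compression_pow_rangeRestrict {x E : End K V} (hx : E * x * E = E * x) (j : ℕ) (v : V) :
    (compression x E ^ j) (E.rangeRestrict v) = E.rangeRestrict ((x ^ j) v) := by
  induction j with
  | zero => rfl
  | succ j ih =>
    rw [pow_succ', pow_succ', Module.End.mul_apply, Module.End.mul_apply, ih]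
    exact Subtype.ext (LinearMap.congr_fun hx ((x ^ j) v))

theorem finrank_range_compression_pow' {x E : End K V} (hx : E * x * E = E * x) (j : ℕ) :
    finrank K (LinearMap.range (compression x E ^ j)) = finrank K (LinearMap.range (E * x ^ j)) := by
  have h : LinearMap.range (E * x ^ j) =
      (LinearMap.range (compression x E ^ j)).map (LinearMap.range E).subtype := by
    ext v
    constructor
    · rintro ⟨u, rfl⟩
      exact ⟨_, ⟨E.rangeRestrict u, rfl⟩,
        congrArg Subtype.val (compression_pow_rangeRestrict hx j u)⟩
    · rintro ⟨_, ⟨⟨_, u, rfl⟩, rfl⟩, rfl⟩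
      exact ⟨u, (congrArg Subtype.val (compression_pow_rangeRestrict hx j u)).symm⟩
  rw [h]
  exact (Submodule.equivMapOfInjective _ (Submodule.subtype_injective _) _).finrank_eq

theorem range_le_range_of_mul_eq {E G : End K V} (h : G * E = E) :
    LinearMap.range E ≤ LinearMap.range G := by
  rintro _ ⟨v, rfl⟩
  exact ⟨E v, LinearMap.congr_fun h v⟩

/-- Compressions of a block triangular endomorphism form an exact triple. -/
theorem exactTriple_compression {x E F : End K V} (hE : E * E = E) (hF : F * F = F)
    (hEF : E * F = 0) (hFE : F * E = 0) (hx : F * x * E = 0) :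
    ExactTriple
      (Submodule.inclusion (range_le_range_of_mul_eq (G := E + F) (by rw [add_mul, hE, hFE, add_zero])))
      (F.rangeRestrict ∘ₗ (LinearMap.range (E + F)).subtype)
      (compression x E) (compression x (E + F)) (compression x F) where
  inj := Submodule.inclusion_injective _
  surj := by
    rintro ⟨_, v, rfl⟩
    refine ⟨⟨F v, F v, ?_⟩, Subtype.ext (LinearMap.congr_fun hF v)⟩
    exact LinearMap.congr_fun (show (E + F) * F = F by rw [add_mul, hF, hEF, zero_add]) v
  exact := by
    rintro ⟨_, v, rfl⟩
    constructor
    · intro h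
      have h : F ((E + F) v) = 0 := congrArg Subtype.val h
      have h' : F ((E + F) v) = F v :=
        LinearMap.congr_fun (show F * (E + F) = F by rw [mul_add, hF, hFE, zero_add]) v
      refine ⟨⟨E v, v, rfl⟩, Subtype.ext ?_⟩
      change E v = (E + F) v
      rw [LinearMap.add_apply, ← h', h, add_zero]
    · rintro ⟨⟨_, u, rfl⟩, hu⟩
      have hu : E u = (E + F) v := congrArg Subtype.val hu
      refine Subtype.ext ?_
      change F ((E + F) v) = 0
      rw [← hu]
      exact LinearMap.congr_fun hFE u
  comm_left := by
    rintro ⟨_, u, rfl⟩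
    refine Subtype.ext ?_
    change E (x (E u)) = (E + F) (x (E u))
    have : F (x (E u)) = 0 := LinearMap.congr_fun hx u
    rw [LinearMap.add_apply, this, add_zero]
  comm_right := by
    rintro ⟨_, u, rfl⟩
    refine Subtype.ext ?_
    change F ((E + F) (x ((E + F) u))) = F (x (F ((E + F) u)))
    have h1 (v : V) : F ((E + F) v) = F v :=
      LinearMap.congr_fun (show F * (E + F) = F by rw [mul_add, hF, hFE, zero_add]) v
    have h2 : F (x (E u)) = 0 := LinearMap.congr_fun hx u
    rw [h1, h1, LinearMap.add_apply, map_add, map_add, h2, zero_add]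

theorem finrank_range_add_le [FiniteDimensional K V] (f g : End K V) :
    finrank K (LinearMap.range (f + g)) ≤
      finrank K (LinearMap.range f) + finrank K (LinearMap.range g) :=
  (Submodule.finrank_mono (LinearMap.range_add_le f g)).trans
    (Submodule.finrank_add_le_finrank_add_finrank _ _)

/-- `z` is the block diagonal part of `x`, which is block triangular for the decomposition
of `V` defined by the projections `Em`, `E₀`, `Ep`. -/
structure IsBlockDiagonalPart (x z Em E₀ Ep : End K V) : Prop where
  sum_eq : Em + E₀ + Ep = 1
  mm : Em * Em = Em
  oo : E₀ * E₀ = E₀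
  pp : Ep * Ep = Ep
  mo : Em * E₀ = 0
  om : E₀ * Em = 0
  mp : Em * Ep = 0
  pm : Ep * Em = 0
  op : E₀ * Ep = 0
  po : Ep * E₀ = 0
  x_mo : Em * x * E₀ = 0
  x_mp : Em * x * Ep = 0
  x_op : E₀ * x * Ep = 0
  comm_m : Commute Em z
  comm_o : Commute E₀ z
  comm_p : Commute Ep z
  eq_o : E₀ * x * E₀ = E₀ * z * E₀

theorem convex_endpoints {f : ℕ → ℕ} (hf : ∀ j, 2 * f (j + 1) ≤ f j + f (j + 2)) (m k : ℕ) :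
    f (m + 1) + f (m + k) ≤ f m + f (m + k + 1) := by
  induction k with
  | zero => simp [add_comm]
  | succ k ih =>
    have : 2 * f (m + k + 1) ≤ f (m + k) + f (m + k + 1 + 1) := hf (m + k)
    simp only [← add_assoc] at *
    omega

theorem affine_endpoints {f : ℕ → ℕ} {m M : ℕ}
    (hf : ∀ j, m ≤ j → j + 2 ≤ M → f j + f (j + 2) ≤ 2 * f (j + 1)) {k : ℕ} (hk : m + k + 1 ≤ M) :
    f m + f (m + k + 1) ≤ f (m + 1) + f (m + k) := by
  induction k with
  | zero => simp [add_comm]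
  | succ k ih =>
    have h1 : f (m + k) + f (m + k + 1 + 1) ≤ 2 * f (m + k + 1) :=
      hf (m + k) (by omega) (by omega)
    have h2 := ih (by omega)
    simp only [← add_assoc] at *
    omega

namespace IsBlockDiagonalPart

variable {x z Em E₀ Ep : End K V}

theorem self (h : IsBlockDiagonalPart x z Em E₀ Ep) : IsBlockDiagonalPart z z Em E₀ Ep where
  __ := h
  x_mo := by rw [h.comm_m.eq, mul_assoc, h.mo, mul_zero]
  x_mp := by rw [h.comm_m.eq, mul_assoc, h.mp, mul_zero]
  x_op := by rw [h.comm_o.eq, mul_assoc, h.op, mul_zero]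
  eq_o := rfl

theorem mul_x_mul_m (h : IsBlockDiagonalPart x z Em E₀ Ep) : Em * x * Em = Em * x := by
  conv_rhs => rw [← mul_one (Em * x), ← h.sum_eq, mul_add, mul_add, h.x_mo, h.x_mp]
  simp

theorem mul_x_mul_p (h : IsBlockDiagonalPart x z Em E₀ Ep) : Ep * x * Ep = x * Ep := by
  have : (Em + E₀ + Ep) * (x * Ep) = Ep * x * Ep := by
    rw [add_mul, add_mul, ← mul_assoc, ← mul_assoc, ← mul_assoc, h.x_mp, h.x_op]; simp
  rw [← this, h.sum_eq, one_mul]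

theorem finrank_compression_o (h : IsBlockDiagonalPart x z Em E₀ Ep) (j : ℕ) :
    finrank K (LinearMap.range (compression x E₀ ^ j)) =
      finrank K (LinearMap.range (z ^ j * E₀)) := by
  have hcz : compression x E₀ = compression z E₀ := by
    refine LinearMap.ext fun w => Subtype.ext ?_
    rw [compression_apply, compression_apply]
    have := LinearMap.congr_fun h.eq_o (w : V)
    simpa only [Module.End.mul_apply, apply_of_mem_range h.oo] using this
  rw [hcz, finrank_range_compression_pow h.oo]
  rw [h.comm_o.eq, mul_assoc, h.oo]

theorem exactTriple_outer_assumptions (h : IsBlockDiagonalPart x z Em E₀ Ep) :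
    (Ep + E₀) * (Ep + E₀) = Ep + E₀ ∧ (Ep + E₀) * Em = 0 ∧ Em * (Ep + E₀) = 0 ∧
      Em * x * (Ep + E₀) = 0 := by
  refine ⟨?_, ?_, ?_, ?_⟩
  · rw [add_mul, mul_add, mul_add, h.pp, h.po, h.op, h.oo]; simp
  · rw [add_mul, h.pm, h.om, add_zero]
  · rw [mul_add, h.mp, h.mo, add_zero]
  · rw [mul_add, h.x_mo, h.x_mp, add_zero]

theorem finrank_compression_top (h : IsBlockDiagonalPart x z Em E₀ Ep) (j : ℕ) :
    finrank K (LinearMap.range (compression x (Ep + E₀ + Em) ^ j)) =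
      finrank K (LinearMap.range (x ^ j)) := by
  have hone : Ep + E₀ + Em = 1 := by rw [← h.sum_eq]; abel
  rw [finrank_range_compression_pow (by rw [hone, one_mul]) (by rw [hone, one_mul]), hone, mul_one]

variable [FiniteDimensional K V]

/-- The ranges of `Ep` and `Ep + E₀` are stable under `x`; ranks are superadditive along this
filtration, whose middle quotient sees `z` as well as `x`. -/
theorem finrank_add_le (h : IsBlockDiagonalPart x z Em E₀ Ep) (j : ℕ) :
    finrank K (LinearMap.range (x ^ j * Ep)) + finrank K (LinearMap.range (z ^ j * E₀)) +
      finrank K (LinearMap.range (Em * x ^ j)) ≤ finrank K (LinearMap.range (x ^ j)) := by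
  obtain ⟨e1, e2, e3, e4⟩ := h.exactTriple_outer_assumptions
  have T1 := ((exactTriple_compression h.pp h.oo h.po h.op h.x_op).pow j).finrank_add_le
  have T2 := ((exactTriple_compression e1 h.mm e2 e3 e4).pow j).finrank_add_le
  rw [h.finrank_compression_top, finrank_range_compression_pow' h.mul_x_mul_m] at T2
  rw [h.finrank_compression_o, finrank_range_compression_pow h.pp h.mul_x_mul_p] at T1
  omega

theorem finrank_self_le (h : IsBlockDiagonalPart x z Em E₀ Ep) (j : ℕ) :
    finrank K (LinearMap.range (z ^ j)) ≤ finrank K (LinearMap.range (z ^ j * Ep)) +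
      finrank K (LinearMap.range (z ^ j * E₀)) + finrank K (LinearMap.range (Em * z ^ j)) := by
  have hd : z ^ j = Em * z ^ j + z ^ j * E₀ + z ^ j * Ep := by
    rw [(h.comm_m.pow_right j).eq, ← mul_add, ← mul_add, h.sum_eq, mul_one]
  have i1 := finrank_range_add_le (Em * z ^ j + z ^ j * E₀) (z ^ j * Ep)
  have i2 := finrank_range_add_le (Em * z ^ j) (z ^ j * E₀)
  rw [← hd] at i1
  omega

/-- If `x` and its block diagonal part `z` have powers of equal ranks in degrees `m` and `M`, and
`z` has at most one Jordan block of each size strictly between, then the outer blocks contribute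
none of these, and the ranks agree in degree `M - 1`. -/
theorem finrank_range_eq (h : IsBlockDiagonalPart x z Em E₀ Ep) {m k : ℕ}
    (hp : ∀ j, finrank K (LinearMap.range (z ^ j * Ep)) ≤ finrank K (LinearMap.range (x ^ j * Ep)))
    (hm : ∀ j, finrank K (LinearMap.range (Em * z ^ j)) ≤ finrank K (LinearMap.range (Em * x ^ j)))
    (hmp : ∀ j,
      finrank K (LinearMap.range (Em * z ^ j)) = finrank K (LinearMap.range (z ^ j * Ep)))
    (hxz : ∀ j, j = m ∨ j = m + k + 1 →
      finrank K (LinearMap.range (x ^ j)) = finrank K (LinearMap.range (z ^ j)))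
    (hz : ∀ j, m ≤ j → j + 2 ≤ m + k + 1 → finrank K (LinearMap.range (z ^ j)) +
      finrank K (LinearMap.range (z ^ (j + 2))) ≤
        2 * finrank K (LinearMap.range (z ^ (j + 1))) + 1) :
    finrank K (LinearMap.range (x ^ (m + k))) ≤ finrank K (LinearMap.range (z ^ (m + k))) := by
  obtain ⟨e1, e2, e3, e4⟩ := h.exactTriple_outer_assumptions
  have T1 := exactTriple_compression h.pp h.oo h.po h.op h.x_op
  have T2 := exactTriple_compression e1 h.mm e2 e3 e4
  set α : ℕ → ℕ := fun j => finrank K (LinearMap.range (compression x Ep ^ j)) with hα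
  set β : ℕ → ℕ := fun j => finrank K (LinearMap.range (compression x (Ep + E₀) ^ j)) with hβ
  set γ : ℕ → ℕ := fun j => finrank K (LinearMap.range (compression x Em ^ j)) with hγ
  set ρ : ℕ → ℕ := fun j => finrank K (LinearMap.range (x ^ j)) with hρ
  set ζ : ℕ → ℕ := fun j => finrank K (LinearMap.range (z ^ j)) with hζ
  set σ : ℕ → ℕ := fun j => finrank K (LinearMap.range (z ^ j * Ep)) with hσ
  set τ : ℕ → ℕ := fun j => finrank K (LinearMap.range (z ^ j * E₀)) with hτ
  have hσα (j : ℕ) : σ j ≤ α j :=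
    (hp j).trans_eq (finrank_range_compression_pow h.pp h.mul_x_mul_p j).symm
  have hσγ (j : ℕ) : σ j ≤ γ j := by
    have := (hm j).trans_eq (finrank_range_compression_pow' h.mul_x_mul_m j).symm
    rwa [hmp] at this
  have hσconv (j : ℕ) : 2 * σ (j + 1) ≤ σ j + σ (j + 2) := by
    simp only [hσ, ← finrank_range_compression_pow h.pp h.self.mul_x_mul_p]
    exact finrank_range_pow_convex _ j
  have hτconv (j : ℕ) : 2 * τ (j + 1) ≤ τ j + τ (j + 2) := by
    simp only [hτ, ← h.finrank_compression_o]
    exact finrank_range_pow_convex _ j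
  have h1 (j : ℕ) : (T1.pow j).Strict ↔ β j ≤ α j + τ j := by
    rw [(T1.pow j).strict_iff, h.finrank_compression_o]
  have h2 (j : ℕ) : (T2.pow j).Strict ↔ ρ j ≤ β j + γ j := by
    rw [(T2.pow j).strict_iff, h.finrank_compression_top]
  have h1' (j : ℕ) : α j + τ j ≤ β j := by
    have := (T1.pow j).finrank_add_le
    rwa [h.finrank_compression_o] at this
  have h2' (j : ℕ) : β j + γ j ≤ ρ j := by
    have := (T2.pow j).finrank_add_le
    rwa [h.finrank_compression_top] at this
  -- `z` is its own block diagonal part, so superadditivity applies to it too, and `hmp` identifies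
  -- the two outer contributions.
  have hζσ (j : ℕ) : ζ j = 2 * σ j + τ j := by
    have i1 : ζ j ≤ σ j + τ j + _ := h.finrank_self_le j
    have i2 : σ j + τ j + _ ≤ ζ j := h.self.finrank_add_le j
    rw [hmp] at i1 i2
    change _ ≤ _ + σ j at i1
    change _ + σ j ≤ _ at i2
    omega
  -- The second difference of `ζ` is at most one and equals twice that of `σ` plus the nonnegative
  -- one of `τ`; so that of `σ` vanishes.
  have haff : ∀ j, m ≤ j → j + 2 ≤ m + k + 1 → σ j + σ (j + 2) ≤ 2 * σ (j + 1) := by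
    intro j hj hj'
    have i1 : ζ j + ζ (j + 2) ≤ 2 * ζ (j + 1) + 1 := hz j hj hj'
    rw [hζσ, hζσ, hζσ] at i1
    have i2 := hτconv j
    omega
  -- At the two ends `ρ ≥ β + γ ≥ α + τ + γ ≥ 2 σ + τ = ζ = ρ`, so every inequality is an equality.
  have hend (j : ℕ) (hj : j = m ∨ j = m + k + 1) :
      α j = σ j ∧ γ j = σ j ∧ β j ≤ α j + τ j ∧ ρ j ≤ β j + γ j := by
    have i0 : ρ j = ζ j := hxz j hj
    have i1 := hζσ j
    have i2 := h1' j
    have i3 := h2' j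
    have i4 := hσα j
    have i5 := hσγ j
    omega
  obtain ⟨a1, a2, a3, a4⟩ := hend m (Or.inl rfl)
  obtain ⟨b1, b2, b3, b4⟩ := hend (m + k + 1) (Or.inr rfl)
  have hσe := affine_endpoints haff le_rfl
  -- `α` lies above the affine function `σ` and meets it at both ends, which is the rank condition
  -- for a gap.
  have nmα : NoMiddleBlocks (compression x Ep) m (m + k + 1) := by
    apply noMiddleBlocks_of_finrank (by omega)
    change α m + α (m + k + 1) ≤ α (m + 1) + α (m + k)
    have i1 := hσα (m + 1)
    have i2 := hσα (m + k)
    omega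
  have nmγ : NoMiddleBlocks (compression x Em) m (m + k + 1) := by
    apply noMiddleBlocks_of_finrank (by omega)
    change γ m + γ (m + k + 1) ≤ γ (m + 1) + γ (m + k)
    have i1 := hσγ (m + 1)
    have i2 := hσγ (m + k)
    omega
  have s1 := (h1 (m + k)).1 (T1.strict_of_noMiddleBlocks_left nmα ((h1 m).2 a3)
    ((h1 (m + k + 1)).2 b3) (by omega) (by omega))
  have s2 := (h2 (m + k)).1 (T2.strict_of_noMiddleBlocks_right nmγ ((h2 m).2 a4)
    ((h2 (m + k + 1)).2 b4) (by omega) (by omega))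
  -- Convexity turns the lower bound `σ ≤ α` at `m + 1` into the upper bound `α ≤ σ` at `m + k`;
  -- likewise for `γ`.
  have cα : α (m + 1) + α (m + k) ≤ α m + α (m + k + 1) :=
    convex_endpoints (fun j => finrank_range_pow_convex _ j) m k
  have cγ : γ (m + 1) + γ (m + k) ≤ γ m + γ (m + k + 1) :=
    convex_endpoints (fun j => finrank_range_pow_convex _ j) m k
  have i1 := hσα (m + 1)
  have i2 := hσγ (m + 1)
  have i3 := hζσ (m + k)
  have i4 : σ (m + 1) + σ (m + k) ≤ σ m + σ (m + k + 1) := convex_endpoints hσconv m k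
  change ρ (m + k) ≤ ζ (m + k)
  omega

end IsBlockDiagonalPart

end Compression

/-! ### Limits along a cocharacter. -/

section Limits

variable {κ : Type*} [Field κ]

theorem polynomial_eq_of_eval_units [Infinite κ] {f g : Polynomial κ}
    (h : ∀ t : κˣ, f.eval (t : κ) = g.eval (t : κ)) : f = g := by
  have h2 : Polynomial.X * f = Polynomial.X * g := by
    refine Polynomial.funext fun a => ?_
    by_cases ha : a = 0
    · simp [ha]
    · have := h (Units.mk0 a ha)
      rw [Units.val_mk0] at this
      simp [this]
  exact mul_left_cancel₀ Polynomial.X_ne_zero h2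

theorem polynomial_eval_zero_of_zpow [Infinite κ] {f : Polynomial κ} {c : κ} {m : ℤ}
    (h : ∀ t : κˣ, f.eval (t : κ) = ((t ^ m : κˣ) : κ) * c) :
    (m < 0 → c = 0) ∧ (m ≠ 0 → f.eval 0 = 0) ∧ (m = 0 → f.eval 0 = c) := by
  rcases lt_trichotomy m 0 with hm | rfl | hm
  · obtain ⟨k, hk⟩ := Int.exists_eq_neg_ofNat hm.le
    have hk0 : k ≠ 0 := by omega
    have h1 : Polynomial.X ^ k * f = Polynomial.C c := by
      refine polynomial_eq_of_eval_units fun t => ?_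
      rw [Polynomial.eval_mul, h, hk, Polynomial.eval_pow, Polynomial.eval_X, Polynomial.eval_C,
        ← mul_assoc, ← Units.val_pow_eq_pow_val, ← Units.val_mul]
      simp
    have hc : c = 0 := by
      have := congrArg (Polynomial.eval 0) h1
      simpa [hk0] using this.symm
    refine ⟨fun _ => hc, fun _ => ?_, fun h0 => absurd h0 hm.ne⟩
    rw [hc, Polynomial.C_0] at h1
    rw [(mul_eq_zero.1 h1).resolve_left (pow_ne_zero _ Polynomial.X_ne_zero), Polynomial.eval_zero]
  · have h1 : f = Polynomial.C c := polynomial_eq_of_eval_units fun t => by simp [h]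
    exact ⟨fun h => absurd h (lt_irrefl _), fun h => absurd rfl h, fun _ => by simp [h1]⟩
  · obtain ⟨k, rfl⟩ := Int.eq_ofNat_of_zero_le hm.le
    have hk0 : k ≠ 0 := by omega
    have h1 : f = Polynomial.X ^ k * Polynomial.C c :=
      polynomial_eq_of_eval_units fun t => by
        rw [h, zpow_natCast, Units.val_pow_eq_pow_val, Polynomial.eval_mul, Polynomial.eval_pow,
          Polynomial.eval_X, Polynomial.eval_C]
    exact ⟨fun h => absurd h hm.not_gt, fun _ => by simp [h1, hk0], fun h => absurd h hm.ne'⟩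

theorem eval_map_C {ι : Type*} (A : Matrix ι ι κ) (t : κ) :
    (A.map Polynomial.C).map (Polynomial.eval t) = A := by
  ext; simp

theorem eval_mul_matrix {ι : Type*} [Fintype ι] (A B : Matrix ι ι (Polynomial κ)) (t : κ) :
    (A * B).map (Polynomial.eval t) = A.map (Polynomial.eval t) * B.map (Polynomial.eval t) :=
  Matrix.map_mul (f := Polynomial.evalRingHom t)

theorem eval_pow_matrix {ι : Type*} [Fintype ι] [DecidableEq ι] (A : Matrix ι ι (Polynomial κ))
    (t : κ) (j : ℕ) : (A ^ j).map (Polynomial.eval t) = A.map (Polynomial.eval t) ^ j :=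
  map_pow (Polynomial.evalRingHom t).mapMatrix A j

variable {n : ℕ} {c : Cocharacter n κ} {x z : sp n κ}

theorem hom_inv_mul_hom (c : Cocharacter n κ) (t : κˣ) :
    ((c.toHom t)⁻¹).1 * (c.toHom t).1 = 1 := congrArg Subtype.val (inv_mul_cancel (c.toHom t))

theorem hom_mul_hom_inv (c : Cocharacter n κ) (t : κˣ) :
    (c.toHom t).1 * ((c.toHom t)⁻¹).1 = 1 := congrArg Subtype.val (mul_inv_cancel (c.toHom t))

theorem conj_pow {R : Type*} [Ring R] {g h x : R} (hgh : h * g = 1) (hg : g * h = 1) (j : ℕ) :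
    (g * x * h) ^ j = g * x ^ j * h := by
  induction j with
  | zero => simp [hg]
  | succ j ih =>
    rw [pow_succ, ih, pow_succ]
    calc _ = g * x ^ j * (h * g) * x * h := by noncomm_ring
      _ = _ := by rw [hgh]; noncomm_ring

/-- Ranks of powers, cut by operators commuting with the cocharacter, do not grow in the limit. -/
theorem HasLimit.rank_mul_pow_mul_le [Infinite κ] (h : HasLimit c x z)
    {E F : Matrix (Fin n ⊕ Fin n) (Fin n ⊕ Fin n) κ}
    (hE : ∀ t, Commute E (c.toHom t).1) (hF : ∀ t, Commute F (c.toHom t).1) (j : ℕ) :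
    (E * z.1 ^ j * F).rank ≤ (E * x.1 ^ j * F).rank := by
  obtain ⟨P, hP, hP0⟩ := h
  have key := rank_eval_zero_le (E.map Polynomial.C * P ^ j * F.map Polynomial.C)
    (E * x.1 ^ j * F).rank (fun t => ?_)
  · rwa [eval_mul_matrix, eval_mul_matrix, eval_pow_matrix, eval_map_C, eval_map_C, hP0] at key
  · rw [eval_mul_matrix, eval_mul_matrix, eval_pow_matrix, eval_map_C, eval_map_C, hP,
      conj_pow (hom_inv_mul_hom c t) (hom_mul_hom_inv c t)]
    have hF' : ((c.toHom t)⁻¹).1 * F = F * ((c.toHom t)⁻¹).1 := by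
      calc _ = ((c.toHom t)⁻¹).1 * (F * (c.toHom t).1) * ((c.toHom t)⁻¹).1 := by
            rw [mul_assoc, mul_assoc, hom_mul_hom_inv, mul_one]
        _ = _ := by rw [(hF t).eq, ← mul_assoc, hom_inv_mul_hom, one_mul]
    have e : E * ((c.toHom t).1 * x.1 ^ j * ((c.toHom t)⁻¹).1) * F =
        (c.toHom t).1 * (E * x.1 ^ j * F) * ((c.toHom t)⁻¹).1 := by
      calc _ = (E * (c.toHom t).1) * x.1 ^ j * (((c.toHom t)⁻¹).1 * F) := by noncomm_ring
        _ = _ := by rw [hF', (hE t).eq]; noncomm_ring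
    rw [e]
    exact (Matrix.rank_mul_le_left _ _).trans (Matrix.rank_mul_le_right _ _)

theorem HasLimit.rank_pow_le [Infinite κ] (h : HasLimit c x z) (j : ℕ) :
    (z.1 ^ j).rank ≤ (x.1 ^ j).rank := by
  simpa using h.rank_mul_pow_mul_le (E := 1) (F := 1) (fun _ => Commute.one_left _)
    (fun _ => Commute.one_left _) j

variable {N : ℕ} {A : ℤ → Matrix (Fin n ⊕ Fin n) (Fin n ⊕ Fin n) κ}

/-- Conjugation by `c t` scales the block from weight `i` to weight `k` by `t ^ (k - i)`.
Polynomiality kills the blocks with negative exponent, and evaluation at `0` keeps only those with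
exponent zero. -/
theorem HasLimit.weight_blocks [Infinite κ] (h : HasLimit c x z) (hA : IsWeightDecomposition c N A)
    (k i : ℤ) : (k < i → A k * x.1 * A i = 0) ∧ (k ≠ i → A k * z.1 * A i = 0) ∧
      (k = i → A k * z.1 * A i = A k * x.1 * A i) := by
  obtain ⟨P, hP, hP0⟩ := h
  set R := (A k).map Polynomial.C * P * (A i).map Polynomial.C with hR
  have hR0 : R.map (Polynomial.eval 0) = A k * z.1 * A i := by
    rw [hR, eval_mul_matrix, eval_mul_matrix, eval_map_C, eval_map_C, hP0]
  have hRt (t : κˣ) : R.map (Polynomial.eval (t : κ)) =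
      ((t ^ (k - i) : κˣ) : κ) • (A k * x.1 * A i) := by
    have hinv : ((c.toHom t)⁻¹).1 * A i = ((t ^ (-i) : κˣ) : κ) • A i := by
      rw [← map_inv, hA.hom_mul, inv_zpow']
    rw [hR, eval_mul_matrix, eval_mul_matrix, eval_map_C, eval_map_C, hP]
    calc _ = (A k * (c.toHom t).1) * x.1 * (((c.toHom t)⁻¹).1 * A i) := by noncomm_ring
      _ = _ := by
        rw [hA.mul_hom, hinv, Matrix.mul_smul, Matrix.smul_mul, Matrix.smul_mul, smul_smul,
          ← Units.val_mul, ← zpow_add, neg_add_eq_sub]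
  have key (a b) := polynomial_eval_zero_of_zpow (f := R a b) (c := (A k * x.1 * A i) a b)
    (m := k - i) (fun t => congrFun (congrFun (hRt t) a) b)
  refine ⟨fun hlt => ?_, fun hne => ?_, fun heq => ?_⟩
  · ext a b; exact (key a b).1 (by omega)
  · rw [← hR0]; ext a b; exact (key a b).2.1 (by omega)
  · rw [← hR0]; ext a b; exact (key a b).2.2 (by omega)

end Limits

/-! ### A single degeneration in the symplectic Lie algebra. -/

section OneStep

variable {κ : Type*} [Field κ] {n : ℕ} {c : Cocharacter n κ} {x z : sp n κ}
  {N : ℕ} {A : ℤ → Matrix (Fin n ⊕ Fin n) (Fin n ⊕ Fin n) κ}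

theorem transpose_mul_J (z : sp n κ) :
    z.1ᵀ * Matrix.J (Fin n) κ = Matrix.J (Fin n) κ * (-z.1) :=
  (mem_skewAdjointMatricesSubmodule _ _).1 z.2

theorem transpose_pow_mul_J (z : sp n κ) (j : ℕ) :
    (z.1 ^ j)ᵀ * Matrix.J (Fin n) κ = Matrix.J (Fin n) κ * (-z.1) ^ j := by
  rw [Matrix.transpose_pow]
  exact (show SemiconjBy (Matrix.J (Fin n) κ) (-z.1) z.1ᵀ from (transpose_mul_J z).symm).pow_right j
    |>.eq.symm

/-- `J * z ^ (2 * j)` is skew-symmetric, because `z` is skew-adjoint and the exponent is even. -/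
theorem even_rank_pow (h2 : (2 : κ) ≠ 0) (z : sp n κ) (j : ℕ) : Even (z.1 ^ (2 * j)).rank := by
  have h := even_rank_of_transpose_eq_neg h2 (A := Matrix.J (Fin n) κ * z.1 ^ (2 * j)) (by
    rw [Matrix.transpose_mul, Matrix.J_transpose, mul_neg, transpose_pow_mul_J,
      (even_two_mul j).neg_pow])
  rwa [Matrix.rank_mul_eq_right_of_isUnit_det _ _ (Matrix.isUnit_det_J _ _)] at h

/-- The projection onto the sum of the weight spaces with weights in `T`. -/
def weightProj (A : ℤ → Matrix (Fin n ⊕ Fin n) (Fin n ⊕ Fin n) κ) (T : Finset ℤ) :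
    Matrix (Fin n ⊕ Fin n) (Fin n ⊕ Fin n) κ := ∑ i ∈ T, A i

namespace IsWeightDecomposition

theorem weightProj_mul_self (hA : IsWeightDecomposition c N A) (T : Finset ℤ) :
    weightProj A T * weightProj A T = weightProj A T := by
  simp only [weightProj, Finset.sum_mul_sum]
  refine Finset.sum_congr rfl fun i hi => ?_
  rw [Finset.sum_eq_single i (fun k _ hk => hA.mul_of_ne hk.symm) (fun h => absurd hi h),
    hA.mul_self]

theorem weightProj_mul_eq_zero (hA : IsWeightDecomposition c N A) {S T : Finset ℤ}
    (h : ∀ i ∈ S, ∀ k ∈ T, i ≠ k) : weightProj A S * weightProj A T = 0 := by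
  simp only [weightProj, Finset.sum_mul_sum]
  exact Finset.sum_eq_zero fun i hi => Finset.sum_eq_zero fun k hk => hA.mul_of_ne (h i hi k hk)

theorem commute_hom (hA : IsWeightDecomposition c N A) (T : Finset ℤ) (t : κˣ) :
    Commute (weightProj A T) (c.toHom t).1 := by
  refine Commute.sum_left _ _ _ fun i _ => ?_
  rw [Commute, SemiconjBy, hA.mul_hom, hA.hom_mul]

theorem weightProj_mul_mul_eq_zero [Infinite κ] (hA : IsWeightDecomposition c N A)
    (h : HasLimit c x z) {S T : Finset ℤ} (hST : ∀ i ∈ S, ∀ k ∈ T, i < k) :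
    weightProj A S * x.1 * weightProj A T = 0 := by
  simp only [weightProj, Finset.sum_mul, Finset.mul_sum]
  exact Finset.sum_eq_zero fun i hi => Finset.sum_eq_zero fun k hk =>
    (h.weight_blocks hA _ _).1 (hST _ (by assumption) _ (by assumption))

theorem commute_limit [Infinite κ] (hA : IsWeightDecomposition c N A) (h : HasLimit c x z)
    (T : Finset ℤ) : Commute (weightProj A T) z.1 := by
  refine Commute.sum_left _ _ _ fun i _ => ?_
  have h1 : A i * z.1 = ∑ k ∈ Finset.Icc (-(N : ℤ)) N, A i * z.1 * A k := by
    rw [← Finset.mul_sum, hA.sum_eq, mul_one]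
  have h2 : z.1 * A i = ∑ k ∈ Finset.Icc (-(N : ℤ)) N, A k * z.1 * A i := by
    simp only [mul_assoc]
    rw [← Finset.sum_mul, hA.sum_eq, one_mul]
  rw [Commute, SemiconjBy, h1, h2]
  refine Finset.sum_congr rfl fun k _ => ?_
  by_cases hk : k = i
  · rw [hk]
  · rw [(h.weight_blocks hA _ _).2.1 hk, (h.weight_blocks hA _ _).2.1 (Ne.symm hk)]

theorem isBlockDiagonalPart [Infinite κ] (hA : IsWeightDecomposition c N A)
    (h : HasLimit c x z) :
    IsBlockDiagonalPart (Matrix.toLinAlgEquiv' x.1) (Matrix.toLinAlgEquiv' z.1)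
      (Matrix.toLinAlgEquiv' (weightProj A (Finset.Icc (-(N : ℤ)) (-1))))
      (Matrix.toLinAlgEquiv' (weightProj A {0}))
      (Matrix.toLinAlgEquiv' (weightProj A (Finset.Icc 1 (N : ℤ)))) where
  sum_eq := by
    rw [← map_add, ← map_add, ← map_one Matrix.toLinAlgEquiv', ← hA.sum_eq]
    congr 1
    rw [weightProj, weightProj, weightProj, ← Finset.sum_union, ← Finset.sum_union]
    · refine Finset.sum_congr ?_ fun _ _ => rfl
      ext i
      simp only [Finset.mem_union, Finset.mem_Icc, Finset.mem_singleton]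
      omega
    all_goals
      rw [Finset.disjoint_left]
      intro i
      simp only [Finset.mem_union, Finset.mem_Icc, Finset.mem_singleton]
      omega
  mm := by rw [← map_mul, hA.weightProj_mul_self]
  oo := by rw [← map_mul, hA.weightProj_mul_self]
  pp := by rw [← map_mul, hA.weightProj_mul_self]
  mo := by
    rw [← map_mul, hA.weightProj_mul_eq_zero, map_zero]
    simp only [Finset.mem_Icc, Finset.mem_singleton]; omega
  om := by
    rw [← map_mul, hA.weightProj_mul_eq_zero, map_zero]
    simp only [Finset.mem_Icc, Finset.mem_singleton]; omega
  mp := by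
    rw [← map_mul, hA.weightProj_mul_eq_zero, map_zero]
    simp only [Finset.mem_Icc]; omega
  pm := by
    rw [← map_mul, hA.weightProj_mul_eq_zero, map_zero]
    simp only [Finset.mem_Icc]; omega
  op := by
    rw [← map_mul, hA.weightProj_mul_eq_zero, map_zero]
    simp only [Finset.mem_Icc, Finset.mem_singleton]; omega
  po := by
    rw [← map_mul, hA.weightProj_mul_eq_zero, map_zero]
    simp only [Finset.mem_Icc, Finset.mem_singleton]; omega
  x_mo := by
    rw [← map_mul, ← map_mul, hA.weightProj_mul_mul_eq_zero h, map_zero]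
    simp only [Finset.mem_Icc, Finset.mem_singleton]; omega
  x_mp := by
    rw [← map_mul, ← map_mul, hA.weightProj_mul_mul_eq_zero h, map_zero]
    simp only [Finset.mem_Icc]; omega
  x_op := by
    rw [← map_mul, ← map_mul, hA.weightProj_mul_mul_eq_zero h, map_zero]
    simp only [Finset.mem_Icc, Finset.mem_singleton]; omega
  comm_m := (hA.commute_limit h _).map Matrix.toLinAlgEquiv'
  comm_o := (hA.commute_limit h _).map Matrix.toLinAlgEquiv'
  comm_p := (hA.commute_limit h _).map Matrix.toLinAlgEquiv'
  eq_o := by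
    rw [← map_mul, ← map_mul, ← map_mul, ← map_mul, weightProj, Finset.sum_singleton,
      (h.weight_blocks hA 0 0).2.2 rfl]

theorem weightProj_transpose_mul_J (hA : IsWeightDecomposition c N A) :
    (weightProj A (Finset.Icc 1 (N : ℤ)))ᵀ * Matrix.J (Fin n) κ =
      Matrix.J (Fin n) κ * weightProj A (Finset.Icc (-(N : ℤ)) (-1)) := by
  simp only [weightProj, Matrix.transpose_sum, Finset.sum_mul, Finset.mul_sum, hA.transpose_mul_J]
  refine Finset.sum_nbij' (fun k => -k) (fun k => -k) (fun k hk => ?_) (fun k hk => ?_)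
    (fun k _ => neg_neg k) (fun k _ => neg_neg k) (fun _ _ => rfl)
  all_goals
    rw [Finset.mem_Icc] at *
    omega

/-- The adjoint for the symplectic form exchanges the projections to positive and negative weights
and sends `z ^ j` to itself up to sign; it preserves rank. -/
theorem rank_weightProj_mul_pow (hA : IsWeightDecomposition c N A) (z : sp n κ) (j : ℕ) :
    (weightProj A (Finset.Icc (-(N : ℤ)) (-1)) * z.1 ^ j).rank =
      (z.1 ^ j * weightProj A (Finset.Icc 1 (N : ℤ))).rank := by
  have h : (z.1 ^ j * weightProj A (Finset.Icc 1 (N : ℤ)))ᵀ * Matrix.J (Fin n) κ =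
      Matrix.J (Fin n) κ * (weightProj A (Finset.Icc (-(N : ℤ)) (-1)) * z.1 ^ j * (-1) ^ j) := by
    rw [Matrix.transpose_mul, mul_assoc, transpose_pow_mul_J, ← mul_assoc,
      hA.weightProj_transpose_mul_J, neg_pow, mul_assoc, mul_assoc,
      ((Commute.neg_one_left z.1).pow_pow j j).eq]
  have hu : IsUnit ((-1 : Matrix (Fin n ⊕ Fin n) (Fin n ⊕ Fin n) κ) ^ j).det :=
    (Matrix.isUnit_iff_isUnit_det _).1 (isUnit_one.neg.pow j)
  calc _ = (weightProj A (Finset.Icc (-(N : ℤ)) (-1)) * z.1 ^ j * (-1) ^ j).rank :=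
        (Matrix.rank_mul_eq_left_of_isUnit_det _ _ hu).symm
    _ = ((z.1 ^ j * weightProj A (Finset.Icc 1 (N : ℤ)))ᵀ * Matrix.J (Fin n) κ).rank := by
        rw [h, Matrix.rank_mul_eq_right_of_isUnit_det _ _ (Matrix.isUnit_det_J (Fin n) κ)]
    _ = _ := by
        rw [Matrix.rank_mul_eq_left_of_isUnit_det _ _ (Matrix.isUnit_det_J (Fin n) κ),
          Matrix.rank_transpose]

end IsWeightDecomposition

/-- A limit `z` of `x` along a cocharacter whose Jordan blocks of sizes strictly between `m` and
`m + k + 1` have multiplicity at most one cannot lose rank in degree `m + k` if it loses none in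
degrees `m` and `m + k + 1`. -/
theorem HasLimit.rank_pow_le_rank_limit_pow [Infinite κ] (h : HasLimit c x z) {m k : ℕ}
    (hxz : ∀ j, j = m ∨ j = m + k + 1 → (x.1 ^ j).rank = (z.1 ^ j).rank)
    (hz : ∀ j, m ≤ j → j + 2 ≤ m + k + 1 →
      (z.1 ^ j).rank + (z.1 ^ (j + 2)).rank ≤ 2 * (z.1 ^ (j + 1)).rank + 1) :
    (x.1 ^ (m + k)).rank ≤ (z.1 ^ (m + k)).rank := by
  obtain ⟨N, A, hA⟩ := exists_isWeightDecomposition c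
  have hr₁ (M : Matrix (Fin n ⊕ Fin n) (Fin n ⊕ Fin n) κ) (j : ℕ) :
      finrank κ (LinearMap.range (Matrix.toLinAlgEquiv' M ^ j)) = (M ^ j).rank := by
    rw [← map_pow]; rfl
  have hr₂ (M E : Matrix (Fin n ⊕ Fin n) (Fin n ⊕ Fin n) κ) (j : ℕ) :
      finrank κ (LinearMap.range (Matrix.toLinAlgEquiv' M ^ j * Matrix.toLinAlgEquiv' E)) =
        (M ^ j * E).rank := by
    rw [← map_pow, ← map_mul]; rfl
  have hr₃ (M E : Matrix (Fin n ⊕ Fin n) (Fin n ⊕ Fin n) κ) (j : ℕ) :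
      finrank κ (LinearMap.range (Matrix.toLinAlgEquiv' E * Matrix.toLinAlgEquiv' M ^ j)) =
        (E * M ^ j).rank := by
    rw [← map_pow, ← map_mul]; rfl
  have key := (hA.isBlockDiagonalPart h).finrank_range_eq (m := m) (k := k)
  simp only [hr₁, hr₂, hr₃] at key
  refine key (fun j => ?_) (fun j => ?_) (hA.rank_weightProj_mul_pow z) hxz hz
  · simpa using h.rank_mul_pow_mul_le (E := 1) (fun _ => Commute.one_left _) (hA.commute_hom _) j
  · simpa using h.rank_mul_pow_mul_le (F := 1) (hA.commute_hom _) (fun _ => Commute.one_left _) j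

theorem rank_pow_eq_of_mem_orbit {y z : sp n κ} (h : z ∈ orbit y) (j : ℕ) :
    (z.1 ^ j).rank = (y.1 ^ j).rank := by
  obtain ⟨g, hg⟩ := h
  rw [hg, conj_pow (congrArg Subtype.val (inv_mul_cancel g))
    (congrArg Subtype.val (mul_inv_cancel g)),
    Matrix.rank_mul_eq_left_of_isUnit_det _ _ (SymplecticGroup.symplectic_det (g⁻¹).2),
    Matrix.rank_mul_eq_right_of_isUnit_det _ _ (SymplecticGroup.symplectic_det g.2)]

theorem exists_partition_of_rank (h2 : (2 : κ) ≠ 0) (z : sp n κ)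
    (hnil : ∃ M, ∀ j, M ≤ j → (z.1 ^ j).rank = 0) :
    ∃ m : Nat.Partition (2 * n), IsSymplecticPartition m ∧
      ∀ j, excess m.parts j = (z.1 ^ j).rank := by
  refine exists_partition_excess_eq (fun j => (z.1 ^ j).rank) ?_ (fun j => ?_) hnil
    (fun j => even_rank_pow h2 z j)
  · simp [two_mul]
  · have := finrank_range_pow_convex (Matrix.toLinAlgEquiv' z.1) j
    rwa [← map_pow, ← map_pow, ← map_pow] at this

end OneStep

/-! ### Chains of degenerations between adjacent types. -/

section Main

variable {κ : Type*} [Field κ] [Infinite κ] {n r s : ℕ} {C : Multiset ℕ}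
  {p q : Nat.Partition (2 * n)}

theorem not_hasLimit_of_adjacentBelow (h2 : (2 : κ) ≠ 0) (hrs : 2 * s + 6 ≤ 2 * r)
    (hp : p.parts = C + ({2 * r, 2 * s} : Multiset ℕ).filter (fun a => a ≠ 0))
    (hq : q.parts = C + {2 * r - 2, 2 * s + 2}) (hadj : AdjacentBelow q p) {x z : sp n κ}
    (hx : ∀ j, (x.1 ^ j).rank = excess p.parts j) (hz : ∀ j, (z.1 ^ j).rank = excess q.parts j)
    (c : Cocharacter n κ) : ¬ HasLimit c x z := by
  intro h
  have hsp : IsSymplecticPartition p :=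
    isSymplecticPartition_of_excess fun j => by rw [← hx]; exact even_rank_pow h2 x j
  -- The excesses of `p` and `q` agree in degrees `m = 2s` and `m + k + 1 = 2r`, and differ by one
  -- in degree `m + k = 2r - 1`.
  have key := h.rank_pow_le_rank_limit_pow (m := 2 * s) (k := 2 * r - 2 * s - 1)
    (fun j hj => by rw [hx, hz, excess_upper hp, excess_lower hq]; omega)
    (fun j hj hj' => by
      rw [hz, hz, hz, excess_add_excess]
      have := count_lower_le_one hrs hq (not_mem_of_adjacentBelow hrs hp hq hadj hsp
        (c := j + 1) (by omega) (by omega))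
      omega)
  rw [hx, hz, excess_upper hp, excess_lower hq] at key
  omega

theorem not_accessible_of_adjacentBelow (h2 : (2 : κ) ≠ 0) (hrs : 2 * s + 6 ≤ 2 * r)
    (hp : p.parts = C + ({2 * r, 2 * s} : Multiset ℕ).filter (fun a => a ≠ 0))
    (hq : q.parts = C + {2 * r - 2, 2 * s + 2}) (hadj : AdjacentBelow q p) {x y : sp n κ}
    (hx : ∀ j, (x.1 ^ j).rank = excess p.parts j) (hy : ∀ j, (y.1 ^ j).rank = excess q.parts j) :
    ¬ Accessible x y := by
  intro hacc
  -- The rank bound is carried along the chain because it supplies the lower half of the squeeze at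
  -- each intermediate element.
  suffices h : (∀ j, (y.1 ^ j).rank ≤ (x.1 ^ j).rank) ∧
      ((∀ j, (x.1 ^ j).rank = excess p.parts j) → False) from h.2 hx
  clear hx
  induction hacc using Relation.ReflTransGen.head_induction_on with
  | refl =>
    refine ⟨fun _ => le_rfl, fun hx => ?_⟩
    have := (hx (2 * r - 1)).symm.trans (hy (2 * r - 1))
    rw [excess_upper hp, excess_lower hq] at this
    omega
  | head hstep _ ih =>
    rename_i w w' _
    obtain ⟨c, z, hlim, hzo⟩ := hstep
    obtain ⟨ih1, ih2⟩ := ih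
    have hle (j : ℕ) : (w'.1 ^ j).rank ≤ (w.1 ^ j).rank := by
      rw [← rank_pow_eq_of_mem_orbit hzo]; exact hlim.rank_pow_le j
    refine ⟨fun j => (ih1 j).trans (hle j), fun hw => ?_⟩
    obtain ⟨m, hm, hme⟩ := exists_partition_of_rank h2 w' ⟨2 * n, fun j hj => by
      have := hle j
      rw [hw, excess_eq_zero (by rwa [Nat.Partition.parts_sum])] at this
      omega⟩
    -- Either `w'` still has type `p`, and the rest of the chain is contradictory, or this very step
    -- goes from type `p` to type `q`.
    rcases hadj.excess_eq_or hm (fun j => by rw [hme, ← hy]; exact ih1 j)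
      (fun j => by rw [hme, ← hw]; exact hle j) with h | h
    · exact ih2 fun j => by rw [← hme, h]
    · exact not_hasLimit_of_adjacentBelow h2 hrs hp hq hadj hw
        (fun j => by rw [rank_pow_eq_of_mem_orbit hzo, ← hme, h]) c hlim

end Main

end SpAccess

theorem mainTheorem4 {κ : Type*} [Field κ] [IsAlgClosed κ] (hchar : ringChar κ ≠ 2)
    (n r s : ℕ) (hrs : 2 * s + 6 ≤ 2 * r) (C : Multiset ℕ)
    (p q : Nat.Partition (2 * n))
    (hp : p.parts = C + ({2 * r, 2 * s} : Multiset ℕ).filter (fun a => a ≠ 0))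
    (hq : q.parts = C + {2 * r - 2, 2 * s + 2})
    (hadj : SpAccess.AdjacentBelow q p)
    (x y : SpAccess.sp n κ)
    (hx : SpAccess.HasJordanType x.1 p.parts) (hy : SpAccess.HasJordanType y.1 q.parts) :
    ¬ SpAccess.Accessible x y :=
  SpAccess.not_accessible_of_adjacentBelow (Ring.two_ne_zero hchar) hrs hp hq hadj
    (SpAccess.rank_pow_of_hasJordanType hx) (SpAccess.rank_pow_of_hasJordanType hy)
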